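/- Let $\mathcal E=\mathbb Z[\omega]$ with $\omega=e^{2\pi i/3}$, and let $\theta=\omega-\bar\omega=\sqrt{-3}$. Let $\Lambda=\mathcal E^{11}$ with the Hermitian form $\langle x,y\rangle=\sum_{i,j}\lambda_{ij}x_i\bar y_j$, where $$(\lambda_{ij})=\begin{pmatrix}3\end{pmatrix}\oplus B\oplus B\oplus\begin{pmatrix}0&\theta\\ \bar\theta&0\end{pmatrix},\qquad B=\begin{pmatrix}3&\theta&0&0\\ \bar\theta&3&\theta&0\\ 0&\bar\theta&3&\theta\\ 0&0&\bar\theta&3\end{pmatrix}.$$ Let $\Gamma=\mathrm{Aut}(\Lambda)$ be the group of $\mathcal E$-linear automorphisms of $\Lambda$ preserving the form, and let $P\Gamma$ be the quotient of $\Gamma$ by its subgroup of scalars. Let $\mathbb{CH}^{10}$ be the set of complex lines in $\Lambda\otimes_{\mathcal E}\mathbb C$ on which the form is negative definite; $P\Gamma$ acts on it. A vector $r\in\Lambda$ with $\langle r,r\rangle=3$ is called a nodal root if $\langle r,\Lambda\rangle=\theta\mathcal E$, and a chordal root if $\langle r,\Lambda\rangle=3\mathcal E$. The discriminant (respectively chordal)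 hyperplanes are the sets $r^\perp\subseteq\mathbb{CH}^{10}$ of negative lines orthogonal to $r$, for $r$ a nodal (respectively chordal) root. Then $P\Gamma$ acts transitively on the (nonempty) set of discriminant hyperplanes and on the (nonempty) set of chordal hyperplanes; that is, each of these two sets is a single $P\Gamma$-orbit. -/

import Mathlib

open scoped LinearAlgebra.Projectivization Matrix Pointwise ComplexConjugate

noncomputable section

namespace CubicMod

/-- The primitive cube root of unity `ω = (-1 + √3 i) / 2`. -/
def omega : ℂ := ⟨-1 / 2, Real.sqrt 3 / 2⟩

/-- `θ = ω - ω̄ = √-3`. -/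
def theta : ℂ := omega - conj omega

/-- The ring of Eisenstein integers `ℰ = ℤ[ω]`, as a subring of `ℂ`. -/
abbrev Eis : Subring ℂ := Subring.closure {omega}

/-- The inner product matrix
`(3) ⊕ E₈^ℰ ⊕ E₈^ℰ ⊕ [[0, θ], [θ̄, 0]]` of the lattice `Λ`. -/
def gram : Matrix (Fin 11) (Fin 11) ℂ :=
  let t := theta
  let s := conj theta
  !![3, 0, 0, 0, 0, 0, 0, 0, 0, 0, 0;
     0, 3, t, 0, 0, 0, 0, 0, 0, 0, 0;
     0, s, 3, t, 0, 0, 0, 0, 0, 0, 0;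
     0, 0, s, 3, t, 0, 0, 0, 0, 0, 0;
     0, 0, 0, s, 3, 0, 0, 0, 0, 0, 0;
     0, 0, 0, 0, 0, 3, t, 0, 0, 0, 0;
     0, 0, 0, 0, 0, s, 3, t, 0, 0, 0;
     0, 0, 0, 0, 0, 0, s, 3, t, 0, 0;
     0, 0, 0, 0, 0, 0, 0, s, 3, 0, 0;
     0, 0, 0, 0, 0, 0, 0, 0, 0, 0, t;
     0, 0, 0, 0, 0, 0, 0, 0, 0, s, 0]

/-- The complex vector space `Λ ⊗_ℰ ℂ = ℂ¹¹`. -/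
abbrev W : Type := Fin 11 → ℂ

/-- The underlying `ℰ`-module `ℰ¹¹` of the lattice `Λ`. -/
abbrev Lam : Type := Fin 11 → Eis

/-- The inclusion `Λ → Λ ⊗_ℰ ℂ`. -/
def toC (x : Lam) : W := fun i => (x i : ℂ)

/-- The Hermitian form `⟨x | y⟩ = ∑ᵢⱼ λᵢⱼ xᵢ ȳⱼ` on `Λ ⊗_ℰ ℂ`. -/
def herm (x y : W) : ℂ := ∑ i, ∑ j, gram i j * x i * conj (y j)

/-- The Hermitian form on `Λ`. -/
def ip (x y : Lam) : ℂ := herm (toC x) (toC y)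

/-- `Γ = Aut Λ`: the `ℰ`-linear automorphisms of `Λ = ℰ¹¹` (as invertible matrices acting on
column vectors) that preserve the Hermitian form. -/
def Gamma : Subgroup (GL (Fin 11) Eis) where
  carrier := {g | ∀ x y : Lam,
    ip ((g : Matrix (Fin 11) (Fin 11) Eis) *ᵥ x) ((g : Matrix (Fin 11) (Fin 11) Eis) *ᵥ y) = ip x y}
  one_mem' := by intro x y; simp
  mul_mem' := by
    intro a b ha hb x y
    have := ha ((b : Matrix (Fin 11) (Fin 11) Eis) *ᵥ x) ((b : Matrix (Fin 11) (Fin 11) Eis) *ᵥ y)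
    simp only [Matrix.mulVec_mulVec] at this
    rw [Units.val_mul, this]
    exact hb x y
  inv_mem' := by
    intro a ha x y
    have := ha (((a⁻¹ : GL (Fin 11) Eis) : Matrix (Fin 11) (Fin 11) Eis) *ᵥ x)
      (((a⁻¹ : GL (Fin 11) Eis) : Matrix (Fin 11) (Fin 11) Eis) *ᵥ y)
    simp only [Matrix.mulVec_mulVec, Units.mul_inv, Matrix.one_mulVec] at this
    exact this.symm

/-- The subgroup of `Γ` consisting of scalar transformations. -/
def scalars : Subgroup Gamma :=
  ((Matrix.GeneralLinearGroup.scalar (R := Eis) (Fin 11)).range).subgroupOf Gamma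

instance : scalars.Normal := by
  unfold scalars
  rw [← Matrix.GeneralLinearGroup.center_eq_range_scalar]
  infer_instance

/-- `PΓ = PAut Λ`, the quotient of `Γ` by its scalars. -/
abbrev PGamma : Type := Gamma ⧸ scalars

/-- The `ℂ`-linear extension of an automorphism of `Λ` to `Λ ⊗_ℰ ℂ`. -/
def extend : Gamma →* GL (Fin 11) ℂ :=
  (Matrix.GeneralLinearGroup.map Eis.subtype).comp Gamma.subtype

/-- Complex hyperbolic space `ℂH¹⁰`: the lines in `Λ ⊗_ℰ ℂ` on which the Hermitian form is
negative definite. -/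
def CH : Type :=
  {p : ℙ ℂ W // ∀ v ∈ p.submodule, v ≠ 0 → (herm v v).re < 0}

lemma herm_eq (x y : W) : herm x y = x ⬝ᵥ (gram *ᵥ (star y)) := by
  simp only [herm, dotProduct, Matrix.mulVec, Finset.mul_sum]
  refine Finset.sum_congr rfl fun i _ => Finset.sum_congr rfl fun j _ => ?_
  simp only [Pi.star_apply, RCLike.star_def]
  ring

lemma toC_mulVec (g : Gamma) (x : Lam) :
    toC (((g : GL (Fin 11) Eis) : Matrix (Fin 11) (Fin 11) Eis) *ᵥ x) =
      (extend g : Matrix (Fin 11) (Fin 11) ℂ) *ᵥ toC x := by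
  ext i
  simp [toC, extend, Matrix.mulVec, dotProduct]

lemma toC_single (i : Fin 11) : toC (Pi.single i 1) = Pi.single i 1 := by
  ext j
  by_cases h : j = i
  · subst h; simp [toC]
  · simp [toC, h]

lemma gram_conj (A : Matrix (Fin 11) (Fin 11) ℂ) (v w : W) :
    herm (A *ᵥ v) (A *ᵥ w) = v ⬝ᵥ ((Aᵀ * gram * A.map star) *ᵥ star w) := by
  rw [herm_eq, Matrix.star_mulVec, ← Matrix.mulVec_transpose, Matrix.conjTranspose,
    ← Matrix.transpose_map, Matrix.transpose_transpose, Matrix.mulVec_mulVec,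
    dotProduct_comm, Matrix.dotProduct_mulVec, ← Matrix.mulVec_transpose,
    dotProduct_comm, Matrix.mulVec_mulVec, Matrix.mul_assoc]

/-- The `ℂ`-linear extension of an isometry of `Λ` is an isometry. -/
lemma herm_extend (g : Gamma) (v w : W) :
    herm ((extend g : Matrix (Fin 11) (Fin 11) ℂ) *ᵥ v)
      ((extend g : Matrix (Fin 11) (Fin 11) ℂ) *ᵥ w) = herm v w := by
  have key : (extend g : Matrix (Fin 11) (Fin 11) ℂ)ᵀ * gram *
      (extend g : Matrix (Fin 11) (Fin 11) ℂ).map star = gram := by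
    ext i j
    have h := g.2 (Pi.single i 1) (Pi.single j 1)
    simp only [ip] at h
    rw [toC_mulVec, toC_mulVec, toC_single, toC_single, gram_conj, herm_eq] at h
    simpa [← Pi.single_star] using h
  rw [gram_conj, key, herm_eq]

lemma extend_smul_neg (g : Gamma) (p : CH) :
    ∀ v ∈ (extend g • p.1).submodule, v ≠ 0 → (herm v v).re < 0 := by
  obtain ⟨p, hp⟩ := p
  induction p using Projectivization.ind with
  | h v hv =>
    intro w hw hw0
    rw [Projectivization.smul_mk, Projectivization.submodule_mk,
      Submodule.mem_span_singleton] at hw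
    obtain ⟨c, rfl⟩ := hw
    have e : c • (extend g • v) = (extend g : Matrix (Fin 11) (Fin 11) ℂ) *ᵥ (c • v) := by
      rw [Matrix.mulVec_smul]
      rfl
    rw [e, herm_extend]
    refine hp _ ?_ ?_
    · rw [Projectivization.submodule_mk]
      exact Submodule.smul_mem _ _ (Submodule.mem_span_singleton_self v)
    · intro h
      rw [e, h, Matrix.mulVec_zero] at hw0
      exact hw0 rfl

/-- The action of `Γ` on `ℂH¹⁰`. -/
instance : MulAction Gamma CH where
  smul g p := ⟨extend g • p.1, extend_smul_neg g p⟩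
  one_smul p := Subtype.ext (by
    change extend 1 • p.1 = p.1
    rw [map_one, one_smul])
  mul_smul g h p := Subtype.ext (by
    change extend (g * h) • p.1 = extend g • extend h • p.1
    rw [map_mul, mul_smul])

lemma scalars_le_ker : scalars ≤ (MulAction.toPermHom Gamma CH).ker := by
  intro g hg
  obtain ⟨u, hu⟩ := hg
  rw [MonoidHom.mem_ker]
  refine Equiv.ext fun p => Subtype.ext ?_
  change extend g • p.1 = p.1
  have e : extend g = Matrix.GeneralLinearGroup.scalar (Fin 11)
      (Units.map Eis.subtype.toMonoidHom u) := by
    change Matrix.GeneralLinearGroup.map Eis.subtype (Gamma.subtype g) = _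
    rw [← hu, Matrix.GeneralLinearGroup.map_scalar]
    rfl
  rw [e]
  generalize Units.map Eis.subtype.toMonoidHom u = c
  induction p.1 using Projectivization.ind with
  | h v hv =>
    rw [Projectivization.smul_mk, Projectivization.mk_eq_mk_iff]
    exact ⟨c, by simp [Units.smul_def]⟩

/-- The induced action of `PΓ` on `ℂH¹⁰`. -/
instance : MulAction PGamma CH :=
  MulAction.compHom CH (QuotientGroup.lift scalars (MulAction.toPermHom Gamma CH) scalars_le_ker)

/-- A nodal root: a vector `r` of norm `3` with `⟨r | Λ⟩ = θℰ`. -/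
def IsNodalRoot (r : Lam) : Prop :=
  ip r r = 3 ∧ Set.range (fun x : Lam => ip r x) = Set.range (fun a : Eis => theta * (a : ℂ))

/-- A chordal root: a vector `r` of norm `3` with `⟨r | Λ⟩ = 3ℰ`. -/
def IsChordalRoot (r : Lam) : Prop :=
  ip r r = 3 ∧ Set.range (fun x : Lam => ip r x) = Set.range (fun a : Eis => 3 * (a : ℂ))

/-- The hyperplane `r^⊥ ⊆ ℂH¹⁰`. -/
def perp (r : Lam) : Set CH := {p | ∀ v ∈ p.1.submodule, herm v (toC r) = 0}

/-- The set of discriminant hyperplanes in `ℂH¹⁰`. -/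
def discriminantHyperplanes : Set (Set CH) := {H | ∃ r : Lam, IsNodalRoot r ∧ H = perp r}

/-- The set of chordal hyperplanes in `ℂH¹⁰`. -/
def chordalHyperplanes : Set (Set CH) := {H | ∃ r : Lam, IsChordalRoot r ∧ H = perp r}

end CubicMod

end

/-!
Write `σ = e 9`, `ρ = e 10` for the standard basis of the hyperbolic plane, so that `Λ = K ⊕ ⟨σ, ρ⟩`
with `K = (3) ⊕ B ⊕ B`, and `θη` for the generator of `⟨r, Λ⟩`: `η = 1` for nodal roots and `η = θ`
for chordal roots. It is shown that every root `r` with `⟨r, Λ⟩ = θηℰ` is mapped by `Γ` to a fixed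
root `k₀ ∈ K`, namely `e 1` or `e 0`; both statements of the theorem follow at once. The argument is
an elementary form of strong approximation for the stabilizer of `k₀`.

The vector `s = r - k₀` defines a rational isometry `x ↦ x - ⟨x, s⟩ / (θηδ) s` which maps `r` to
`k₀`, where `δ ∈ ℰ` is given by `3 - ⟨r, k₀⟩ = θηδ`. It does not preserve `Λ`, but the lattice it
produces differs from `Λ` only by a "`δ`-neighbour step" in the direction of `s`. If that direction
is congruent to `σ` modulo `δ`, then the isometry `σ ↦ δ σ`, `ρ ↦ δ̄⁻¹ ρ`, which fixes `k₀`, undoes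
the step, and the composite lies in `Γ` (`gammaEquiv_of_congruence`).

The congruence is arranged by Eichler transvections (`exists_transvection`) and the element
`σ ↦ ρ ↦ -σ` of `Γ` (`exists_swap`). Write `ηa` and `ηb` for the coordinates of `r` at `σ` and `ρ`.
Transvections change `b` modulo `a` by `⟨r, l⟩ / (θη)`, `l ∈ K`, hence make `a` and `b` coprime
(`IsRoot.exists_isCoprime`). Then some `b + n a` with `n ∈ ℤ` has norm coprime to the norm of `δ`
(`exists_coprime_nrm`), and it becomes the new `a`, while `δ` does not change. Finally, as `a` is
invertible modulo `δ`, a transvection along a vector of `K` orthogonal to `k₀` makes the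
`K`-component of `r` congruent to `k₀` modulo `δ`. The equation `⟨r, r⟩ = 3` then determines
`δ + η̄ ā b` modulo `δ δ̄` up to a rational integer multiple of `η̄`, and an integral translation
`b ↦ b + n a` makes it zero modulo `δ δ̄` (`IsRoot.gammaEquiv`).
-/

noncomputable section

namespace CubicMod

/-! ### Arithmetic of the Eisenstein integers -/

lemma omega_sq : omega * omega = -1 - omega := by
  have h3 : (Real.sqrt 3) * Real.sqrt 3 = 3 := Real.mul_self_sqrt (by norm_num)
  apply Complex.ext
  · simp only [omega, Complex.mul_re, Complex.sub_re, Complex.neg_re, Complex.one_re]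
    linarith
  · simp only [omega, Complex.mul_im, Complex.sub_im, Complex.neg_im, Complex.one_im]
    ring

lemma conj_omega : conj omega = -1 - omega := by
  apply Complex.ext
  · simp only [omega, Complex.conj_re, Complex.sub_re, Complex.neg_re, Complex.one_re]
    ring
  · simp only [omega, Complex.conj_im, Complex.sub_im, Complex.neg_im, Complex.one_im]
    ring

lemma theta_eq : theta = 1 + 2 * omega := by
  rw [theta, conj_omega]; ring

lemma theta_sq : theta * theta = -3 := by
  rw [theta_eq]; linear_combination 4 * omega_sq

lemma theta_ne_zero : theta ≠ 0 := fun h => by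
  have := theta_sq
  rw [h] at this
  norm_num at this

lemma conj_theta : conj theta = -theta := by
  simp only [theta, map_sub, Complex.conj_conj]; ring

lemma omega_mem : omega ∈ Eis := Subring.subset_closure rfl

lemma theta_mem : theta ∈ Eis := by
  rw [theta_eq]
  exact add_mem (one_mem _) (mul_mem (ofNat_mem _ 2) omega_mem)

lemma mem_Eis {z : ℂ} : z ∈ Eis ↔ ∃ x y : ℤ, z = x + y * omega := by
  constructor
  · intro h
    induction h using Subring.closure_induction with
    | mem z hz => exact ⟨0, 1, by rw [Set.mem_singleton_iff.mp hz]; push_cast; ring⟩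
    | zero => exact ⟨0, 0, by push_cast; ring⟩
    | one => exact ⟨1, 0, by push_cast; ring⟩
    | add z w _ _ hz hw =>
      obtain ⟨x, y, rfl⟩ := hz
      obtain ⟨x', y', rfl⟩ := hw
      exact ⟨x + x', y + y', by push_cast; ring⟩
    | neg z _ hz =>
      obtain ⟨x, y, rfl⟩ := hz
      exact ⟨-x, -y, by push_cast; ring⟩
    | mul z w _ _ hz hw =>
      obtain ⟨x, y, rfl⟩ := hz
      obtain ⟨x', y', rfl⟩ := hw
      refine ⟨x * x' - y * y', x * y' + y * x' - y * y', ?_⟩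
      push_cast
      linear_combination (y : ℂ) * y' * omega_sq
  · rintro ⟨x, y, rfl⟩
    exact add_mem (intCast_mem _ _) (mul_mem (intCast_mem _ _) omega_mem)

lemma conj_mem {z : ℂ} (h : z ∈ Eis) : conj z ∈ Eis := by
  obtain ⟨x, y, rfl⟩ := mem_Eis.mp h
  refine mem_Eis.mpr ⟨x - y, -y, ?_⟩
  simp only [map_add, map_mul, conj_omega, map_intCast]
  push_cast
  ring

lemma mul_conj_add_omega (x y : ℤ) :
    ((x : ℂ) + y * omega) * conj ((x : ℂ) + y * omega) = ((x * x - x * y + y * y : ℤ) : ℂ) := by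
  simp only [map_add, map_mul, conj_omega, map_intCast]
  push_cast
  linear_combination -(y : ℂ) * y * omega_sq

lemma normSq_add_omega (x y : ℝ) :
    Complex.normSq ((x : ℂ) + y * omega) = x * x - x * y + y * y := by
  have h3 : (Real.sqrt 3) * Real.sqrt 3 = 3 := Real.mul_self_sqrt (by norm_num)
  simp only [Complex.normSq_apply, omega, Complex.add_re, Complex.add_im, Complex.mul_re,
    Complex.mul_im, Complex.ofReal_re, Complex.ofReal_im]
  linear_combination y * y / 4 * h3

/-- The norm `z z̄` of an Eisenstein integer is a natural number. -/
lemma exists_norm {z : ℂ} (h : z ∈ Eis) : ∃ n : ℕ, z * conj z = n ∧ Complex.normSq z = n := by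
  obtain ⟨x, y, rfl⟩ := mem_Eis.mp h
  have h0 : 0 ≤ x * x - x * y + y * y := by nlinarith [sq_nonneg (2 * x - y), sq_nonneg y]
  obtain ⟨n, hn⟩ := Int.eq_ofNat_of_zero_le h0
  have e := mul_conj_add_omega x y
  rw [hn] at e
  refine ⟨n, by simpa using e, ?_⟩
  rw [Complex.mul_conj] at e
  exact_mod_cast e

/-- The coordinates with respect to `1, ω` of an Eisenstein integer are unique. -/
lemma omega_coord {x y : ℤ} (h : (x : ℂ) + y * omega = 0) : x = 0 ∧ y = 0 := by
  have e := normSq_add_omega x y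
  push_cast at e
  rw [h, map_zero] at e
  have e' : x * x - x * y + y * y = 0 := by exact_mod_cast e.symm
  constructor <;> nlinarith [sq_nonneg (2 * x - y), sq_nonneg (2 * y - x), sq_nonneg x, sq_nonneg y]

/-- Rounding the coordinates with respect to `1, ω` gives an Eisenstein integer at distance less
than one. -/
lemma exists_normSq_sub_lt (z : ℂ) : ∃ q ∈ Eis, Complex.normSq (z - q) < 1 := by
  have h3 : 0 < Real.sqrt 3 := Real.sqrt_pos.mpr (by norm_num)
  set y : ℝ := 2 * z.im / Real.sqrt 3 with hy
  set x : ℝ := z.re + y / 2 with hx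
  have hz : z = x + y * omega := by
    apply Complex.ext
    · simp [omega, hx]; ring
    · simp only [omega, hy, Complex.add_im, Complex.mul_im, Complex.ofReal_re, Complex.ofReal_im]
      field_simp
      ring
  refine ⟨(round x : ℤ) + (round y : ℤ) * omega, mem_Eis.mpr ⟨_, _, rfl⟩, ?_⟩
  have e : z - ((round x : ℤ) + (round y : ℤ) * omega) =
      ((x - round x : ℝ) : ℂ) + ((y - round y : ℝ) : ℂ) * omega := by
    conv_lhs => rw [hz]
    push_cast
    ring
  rw [e, normSq_add_omega]
  have h1 := abs_le.mp (abs_sub_round x)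
  have h2 := abs_le.mp (abs_sub_round y)
  nlinarith [h1.1, h1.2, h2.1, h2.2, mul_nonneg (sub_nonneg.2 h1.1) (sub_nonneg.2 h1.2)]

instance : IsPrincipalIdealRing Eis := by
  refine ⟨fun I => ?_⟩
  by_cases hI : I = ⊥
  · rw [hI]; infer_instance
  obtain ⟨x, hx, hx0⟩ := Submodule.exists_mem_ne_zero_of_ne_bot hI
  -- a nonzero element of minimal norm generates
  have hex : ∃ n : ℕ, ∃ d ∈ I, d ≠ 0 ∧ Complex.normSq (d : ℂ) = n :=
    let ⟨n, _, hn⟩ := exists_norm x.2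
    ⟨n, x, hx, hx0, hn⟩
  classical
  obtain ⟨d, hd, hd0, hdn⟩ := Nat.find_spec hex
  have hmin := fun m hm => Nat.find_min hex (m := m) hm
  refine ⟨d, le_antisymm (fun y hy => ?_) ((Ideal.span_singleton_le_iff_mem I).mpr hd)⟩
  obtain ⟨q, hq, hlt⟩ := exists_normSq_sub_lt ((y : ℂ) / d)
  have hd0' : (d : ℂ) ≠ 0 := fun h => hd0 (Subtype.ext h)
  have hmem : y - ⟨q, hq⟩ * d ∈ I := I.sub_mem hy (I.mul_mem_left _ hd)
  have hz : y - ⟨q, hq⟩ * d = 0 := by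
    by_contra h
    obtain ⟨n, _, hn⟩ := exists_norm (y - ⟨q, hq⟩ * d).2
    refine hmin n ?_ ⟨_, hmem, h, hn⟩
    have e : ((y - ⟨q, hq⟩ * d : Eis) : ℂ) = ((y : ℂ) / d - q) * d := by
      push_cast
      field_simp
    have hpos : 0 < Complex.normSq (d : ℂ) := Complex.normSq_pos.mpr hd0'
    rw [e, map_mul, hdn] at hn
    rw [hdn] at hpos
    have : (n : ℝ) < (Nat.find hex : ℝ) := by rw [← hn]; nlinarith
    exact_mod_cast this
  rw [sub_eq_zero.mp hz]
  exact Ideal.mem_span_singleton'.mpr ⟨_, rfl⟩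

/-- In a principal ideal domain, a residue class modulo an ideal `I` which together with `a` and
`b` generates the unit ideal can be used to make `b` coprime to `a ≠ 0`. -/
lemma exists_isCoprime_add {R : Type*} [CommRing R] [IsDomain R] [IsPrincipalIdealRing R]
    (I : Ideal R) (b : R) {a : R} (ha : a ≠ 0) (h : ∃ u v, ∃ i ∈ I, u * a + v * b + i = 1) :
    ∃ z ∈ I, IsCoprime a (b + z) := by
  induction a using UniqueFactorizationMonoid.induction_on_prime with
  | h₁ => exact absurd rfl ha
  | h₂ x hx =>
    obtain ⟨u, rfl⟩ := hx
    exact ⟨0, I.zero_mem, ((u⁻¹ : Rˣ) : R), 0, by simp⟩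
  | h₃ a p ha0 hp ih =>
    obtain ⟨u, v, i, hi, e⟩ := h
    obtain ⟨z, hz, hc⟩ := ih ha0 ⟨u * p, v, i, hi, by rw [← e]; ring⟩
    have hirr := hp.irreducible
    by_cases hpb : p ∣ b + z
    · have hpa : ¬ p ∣ a := fun hpa => hp.not_isUnit (hc.isUnit_of_dvd' hpa hpb)
      obtain ⟨i', hi', hpi⟩ : ∃ i' ∈ I, ¬ p ∣ i' := by
        by_contra! hcon
        have hb : p ∣ b := by simpa using dvd_sub hpb (hcon z hz)
        refine hp.not_isUnit (isUnit_of_dvd_one ?_)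
        rw [← e]
        exact dvd_add (dvd_add (dvd_mul_of_dvd_right (dvd_mul_right _ _) _)
          (dvd_mul_of_dvd_right hb _)) (hcon i hi)
      refine ⟨z + a * i', I.add_mem hz (I.mul_mem_left _ hi'), IsCoprime.mul_left ?_ ?_⟩
      · refine (hirr.coprime_iff_not_dvd).mpr fun hd => ?_
        rw [← add_assoc] at hd
        rcases hp.dvd_or_dvd ((dvd_add_right hpb).mp hd) with h | h
        exacts [hpa h, hpi h]
      · rw [← add_assoc]
        exact hc.add_mul_left_right i'
    · exact ⟨z, hz, IsCoprime.mul_left ((hirr.coprime_iff_not_dvd).mpr hpb) hc⟩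

/-- Complex conjugation on the Eisenstein integers. -/
def conjE : Eis →+* Eis := (starRingEnd ℂ).restrict Eis Eis fun _ => conj_mem

lemma coe_conjE (z : Eis) : (conjE z : ℂ) = conj (z : ℂ) := rfl

/-- The norm `z z̄` of an Eisenstein integer, as a natural number. -/
def nrm (z : Eis) : ℕ := (exists_norm z.2).choose

lemma mul_conj_eq (z : Eis) : (z : ℂ) * conj (z : ℂ) = nrm z := (exists_norm z.2).choose_spec.1

lemma mul_conjE_eq (z : Eis) : z * conjE z = nrm z :=
  Subtype.ext (by simpa [coe_conjE] using mul_conj_eq z)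

lemma nrm_mul (z w : Eis) : nrm (z * w) = nrm z * nrm w := by
  have h : ((nrm (z * w) : ℕ) : ℂ) = (nrm z * nrm w : ℕ) := by
    push_cast
    rw [← mul_conj_eq, ← mul_conj_eq, ← mul_conj_eq]
    push_cast
    rw [map_mul]
    ring
  exact_mod_cast h

lemma nrm_natCast (n : ℕ) : nrm n = n * n := by
  have h : ((nrm n : ℕ) : ℂ) = (n * n : ℕ) := by
    rw [← mul_conj_eq]
    simp
  exact_mod_cast h

lemma nrm_neg (z : Eis) : nrm (-z) = nrm z := by
  have h : ((nrm (-z) : ℕ) : ℂ) = nrm z := by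
    rw [← mul_conj_eq, ← mul_conj_eq]
    simp
  exact_mod_cast h

lemma nrm_theta : nrm ⟨theta, theta_mem⟩ = 3 := by
  have h : ((nrm ⟨theta, theta_mem⟩ : ℕ) : ℂ) = (3 : ℕ) := by
    rw [← mul_conj_eq, conj_theta]
    push_cast
    linear_combination -theta_sq
  exact_mod_cast h

lemma nrm_ne_zero {z : Eis} (hz : z ≠ 0) : nrm z ≠ 0 := by
  intro h
  have := mul_conj_eq z
  rw [h] at this
  simp at this
  exact hz this

/-- The prime `2` is inert. -/
lemma two_dvd_of_two_dvd_nrm {z : Eis} (h : 2 ∣ nrm z) : (2 : Eis) ∣ z := by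
  obtain ⟨x, y, hz⟩ := mem_Eis.mp z.2
  have e : ((nrm z : ℤ)) = x * x - x * y + y * y := by
    have h1 := mul_conj_eq z
    rw [hz, mul_conj_add_omega] at h1
    exact_mod_cast h1.symm
  have h2 : (2 : ℤ) ∣ x * x - x * y + y * y := by rw [← e]; exact_mod_cast h
  have hev : Even (x * x - x * y + y * y) := even_iff_two_dvd.mpr h2
  have : Even x ∧ Even y := by
    rcases Int.even_or_odd x with hx | hx <;> rcases Int.even_or_odd y with hy | hy <;>
      simp_all [Int.even_add, Int.even_sub, Int.even_mul, ← Int.not_even_iff_odd]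
  obtain ⟨⟨x', rfl⟩, ⟨y', rfl⟩⟩ := this
  refine ⟨⟨x' + y' * omega, mem_Eis.mpr ⟨_, _, rfl⟩⟩, Subtype.ext ?_⟩
  have e2 : (((2 : Eis)) : ℂ) = 2 := rfl
  push_cast [hz, e2]
  ring

/-- If `a` and `b` are coprime, no rational prime divides the norms of all `b + n a`. Over a prime
`P` of `ℰ` above `p`, either `b + n a` or its conjugate lies in `P`; the same alternative cannot
occur for two consecutive `n`, so one of them occurs for `n` and `n + 2`, which forces `2 ∈ P`. -/
lemma exists_not_dvd_nrm {a b : Eis} (hab : IsCoprime a b) {p : ℕ} (hp : p.Prime) :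
    ∃ n : ℤ, ¬ p ∣ nrm (b + n * a) := by
  by_contra! hcon
  obtain ⟨u, v, huv⟩ := hab
  have hnu : ¬ IsUnit ((p : ℕ) : Eis) := by
    rintro ⟨w, hw⟩
    have h1 : ((p : ℕ) : Eis) * ((w⁻¹ : Eisˣ) : Eis) = 1 := by rw [← hw]; simp
    have h2 := congrArg nrm h1
    have h3 : nrm 1 = 1 := by simpa using nrm_natCast 1
    rw [nrm_mul, nrm_natCast, h3] at h2
    have := Nat.eq_one_of_mul_eq_one_right (Nat.eq_one_of_mul_eq_one_right h2)
    exact hp.one_lt.ne' this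
  obtain ⟨P, hP, hpP⟩ := Ideal.exists_le_maximal _ ((Ideal.span_singleton_eq_top).not.mpr hnu)
  have hP1 : (1 : Eis) ∉ P := fun h => hP.ne_top ((Ideal.eq_top_iff_one _).mpr h)
  have hprime := hP.isPrime
  have hpP : ((p : ℕ) : Eis) ∈ P := hpP (Ideal.mem_span_singleton_self _)
  have hno : a ∈ P → b ∈ P → False := fun ha hb => hP1 (by
    rw [← huv]; exact P.add_mem (P.mul_mem_left _ ha) (P.mul_mem_left _ hb))
  have hno' : conjE a ∈ P → conjE b ∈ P → False := fun ha hb => hP1 (by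
    rw [← map_one conjE, ← huv, map_add, map_mul, map_mul]
    exact P.add_mem (P.mul_mem_left _ ha) (P.mul_mem_left _ hb))
  have hor : ∀ n : ℤ, b + n * a ∈ P ∨ conjE b + n * conjE a ∈ P := fun n => by
    have h : (b + n * a) * conjE (b + n * a) ∈ P := by
      rw [mul_conjE_eq]
      obtain ⟨k, hk⟩ := hcon n
      rw [hk]
      push_cast
      exact P.mul_mem_right _ hpP
    simpa using hprime.mem_or_mem h
  by_cases h2 : p = 2
  · subst h2
    have h0 := two_dvd_of_two_dvd_nrm (hcon 0)
    have h1 := two_dvd_of_two_dvd_nrm (hcon 1)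
    have h2P : (2 : Eis) ∈ P := by exact_mod_cast hpP
    have h0P := P.mem_of_dvd h0 h2P
    have h1P := P.mem_of_dvd h1 h2P
    simp only [Int.cast_zero, zero_mul, add_zero, Int.cast_one, one_mul] at h0P h1P
    exact hno ((P.add_mem_iff_right h0P).mp h1P) h0P
  · have h2P : (2 : Eis) ∉ P := fun h => hP1 (by
      obtain ⟨k, hk⟩ := hp.odd_of_ne_two h2
      have e : (1 : Eis) = (p : ℕ) - k * 2 := by rw [hk]; push_cast; ring
      rw [e]
      exact P.sub_mem hpP (P.mul_mem_left _ h))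
    have key : ∀ x y : Eis, (x ∈ P → y ∈ P → False) → ∀ m n : ℤ, (n - m = 1 ∨ n - m = 2) →
        y + m * x ∈ P → y + n * x ∈ P → False := by
      intro x y hxy m n hmn hm hn
      have hx : ((n - m : ℤ) : Eis) * x ∈ P := by
        have e : ((n - m : ℤ) : Eis) * x = (y + n * x) - (y + m * x) := by push_cast; ring
        rw [e]
        exact P.sub_mem hn hm
      have hx' : x ∈ P := by
        rcases hmn with h | h <;> rw [h] at hx
        · simpa using hx
        · rcases hprime.mem_or_mem hx with h | h
          · exact absurd (by exact_mod_cast h) h2P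
          · exact h
      exact hxy hx' ((P.add_mem_iff_left (P.mul_mem_left _ hx')).mp hm)
    rcases hor 0 with h0 | h0 <;> rcases hor 1 with h1 | h1
    · exact key _ _ hno 0 1 (by norm_num) h0 h1
    · rcases hor 2 with h2 | h2
      · exact key _ _ hno 0 2 (by norm_num) h0 h2
      · exact key _ _ hno' 1 2 (by norm_num) h1 h2
    · rcases hor 2 with h2 | h2
      · exact key _ _ hno 1 2 (by norm_num) h1 h2
      · exact key _ _ hno' 0 2 (by norm_num) h0 h2
    · exact key _ _ hno' 0 1 (by norm_num) h0 h1

lemma nrm_add_mul (a b : Eis) (n : ℤ) :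
    (nrm (b + n * a) : ℤ) = nrm b + n * (nrm (b + a) - nrm b - nrm a) + n * n * nrm a := by
  have h : ((nrm (b + n * a) : ℕ) : ℂ) =
      nrm b + n * (nrm (b + a) - nrm b - nrm a) + n * n * nrm a := by
    simp only [← mul_conj_eq]
    push_cast
    simp only [map_add, map_mul, map_intCast]
    ring
  exact_mod_cast h

lemma coprime_nrm_congr {a b : Eis} {C : ℕ} {m n : ℤ} (h : n ≡ m [ZMOD C])
    (hm : Nat.Coprime (nrm (b + m * a)) C) : Nat.Coprime (nrm (b + n * a)) C := by
  have h1 : (nrm (b + n * a) : ℤ) ≡ nrm (b + m * a) [ZMOD C] := by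
    rw [nrm_add_mul, nrm_add_mul]
    gcongr
  rw [← Nat.isCoprime_iff_coprime] at hm ⊢
  obtain ⟨k, hk⟩ := h1.symm.dvd
  have e : (nrm (b + n * a) : ℤ) = nrm (b + m * a) + C * k := by linarith
  rw [e]
  exact hm.add_mul_left_left k

/-- If `a` and `b` are coprime, the norm of `b + n a` can be made coprime to a given integer. -/
lemma exists_coprime_nrm {a b : Eis} (hab : IsCoprime a b) {C : ℕ} (hC : C ≠ 0) :
    ∃ n : ℤ, Nat.Coprime (nrm (b + n * a)) C := by
  induction C using Nat.recOnPosPrimePosCoprime with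
  | zero => exact absurd rfl hC
  | one => exact ⟨0, Nat.coprime_one_right _⟩
  | prime_pow p k hp _ =>
    obtain ⟨n, hn⟩ := exists_not_dvd_nrm hab hp
    exact ⟨n, (((Nat.Prime.coprime_iff_not_dvd hp).mpr hn).symm).pow_right k⟩
  | coprime x y _ _ hxy hx hy =>
    obtain ⟨m, hm⟩ := hx (left_ne_zero_of_mul hC)
    obtain ⟨n, hn⟩ := hy (right_ne_zero_of_mul hC)
    obtain ⟨s, t, hst⟩ := Nat.isCoprime_iff_coprime.mpr hxy
    refine ⟨m * (t * y) + n * (s * x), Nat.Coprime.mul_right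
      (coprime_nrm_congr ?_ hm) (coprime_nrm_congr ?_ hn)⟩
    · refine (Int.modEq_iff_dvd.mpr ⟨s * (m - n), ?_⟩)
      linear_combination -m * hst
    · refine (Int.modEq_iff_dvd.mpr ⟨t * (n - m), ?_⟩)
      linear_combination -n * hst

/-! ### The Hermitian form on `ℂ¹¹` -/

lemma herm_add_left (x x' y : W) : herm (x + x') y = herm x y + herm x' y := by
  simp only [herm, Pi.add_apply, mul_add, add_mul, Finset.sum_add_distrib]

lemma herm_smul_left (c : ℂ) (x y : W) : herm (c • x) y = c * herm x y := by
  simp only [herm, Pi.smul_apply, smul_eq_mul, Finset.mul_sum]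
  exact Finset.sum_congr rfl fun i _ => Finset.sum_congr rfl fun j _ => by ring

lemma gram_hermitian (i j : Fin 11) : conj (gram i j) = gram j i := by
  have h3 : (starRingEnd ℂ) 3 = 3 := map_ofNat _ 3
  fin_cases i <;> fin_cases j <;> simp [gram, h3]

lemma conj_herm (x y : W) : conj (herm x y) = herm y x := by
  simp only [herm, map_sum, map_mul, Complex.conj_conj, gram_hermitian]
  rw [Finset.sum_comm]
  exact Finset.sum_congr rfl fun i _ => Finset.sum_congr rfl fun j _ => by ring

lemma herm_add_right (x y y' : W) : herm x (y + y') = herm x y + herm x y' := by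
  simp only [← conj_herm _ x, herm_add_left, map_add]

lemma herm_smul_right (c : ℂ) (x y : W) : herm x (c • y) = conj c * herm x y := by
  simp only [← conj_herm _ x, herm_smul_left, map_mul]

@[simp] lemma herm_zero_right (x : W) : herm x 0 = 0 := by simp [herm]

lemma herm_neg_left (x y : W) : herm (-x) y = -herm x y := by
  rw [← neg_one_smul ℂ, herm_smul_left, neg_one_mul]

lemma herm_neg_right (x y : W) : herm x (-y) = -herm x y := by
  rw [← conj_herm, herm_neg_left, map_neg, conj_herm]

lemma herm_sub_left (x x' y : W) : herm (x - x') y = herm x y - herm x' y := by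
  rw [sub_eq_add_neg, herm_add_left, herm_neg_left, sub_eq_add_neg]

lemma herm_sub_right (x y y' : W) : herm x (y - y') = herm x y - herm x y' := by
  rw [sub_eq_add_neg, herm_add_right, herm_neg_right, sub_eq_add_neg]

/-- The Hermitian form as a linear functional of its first argument. -/
def hermL (y : W) : W →ₗ[ℂ] ℂ where
  toFun x := herm x y
  map_add' x x' := herm_add_left x x' y
  map_smul' c x := by simp [herm_smul_left]

@[simp] lemma hermL_apply (x y : W) : hermL y x = herm x y := rfl

/-- The vectors `e i` of the standard basis of `ℂ¹¹`. -/
def e (i : Fin 11) : W := Pi.single i 1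

lemma herm_e (x : W) (i : Fin 11) : herm x (e i) = ∑ j, gram j i * x j := by
  simp only [herm, e]
  refine Finset.sum_congr rfl fun j _ => ?_
  rw [Finset.sum_eq_single i]
  · simp
  · intro b _ hb; simp [hb]
  · simp

lemma herm_e_zero (x : W) : herm x (e 0) = 3 * x 0 := by
  simp [herm_e, gram, Fin.sum_univ_succ]
lemma herm_e_one (x : W) : herm x (e 1) = 3 * x 1 - theta * x 2 := by
  simp [herm_e, gram, Fin.sum_univ_succ, conj_theta]; try ring
lemma herm_e_two (x : W) : herm x (e 2) = theta * x 1 + 3 * x 2 - theta * x 3 := by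
  simp [herm_e, gram, Fin.sum_univ_succ, conj_theta]; try ring
lemma herm_e_three (x : W) : herm x (e 3) = theta * x 2 + 3 * x 3 - theta * x 4 := by
  simp [herm_e, gram, Fin.sum_univ_succ, conj_theta]; try ring
lemma herm_e_four (x : W) : herm x (e 4) = theta * x 3 + 3 * x 4 := by
  simp [herm_e, gram, Fin.sum_univ_succ, conj_theta]; try ring
lemma herm_e_five (x : W) : herm x (e 5) = 3 * x 5 - theta * x 6 := by
  simp [herm_e, gram, Fin.sum_univ_succ, conj_theta]; try ring
lemma herm_e_six (x : W) : herm x (e 6) = theta * x 5 + 3 * x 6 - theta * x 7 := by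
  simp [herm_e, gram, Fin.sum_univ_succ, conj_theta]; try ring
lemma herm_e_seven (x : W) : herm x (e 7) = theta * x 6 + 3 * x 7 - theta * x 8 := by
  simp [herm_e, gram, Fin.sum_univ_succ, conj_theta]; try ring
lemma herm_e_eight (x : W) : herm x (e 8) = theta * x 7 + 3 * x 8 := by
  simp [herm_e, gram, Fin.sum_univ_succ, conj_theta]; try ring
lemma herm_e_nine (x : W) : herm x (e 9) = -theta * x 10 := by
  simp [herm_e, gram, Fin.sum_univ_succ, conj_theta]; try ring
lemma herm_e_ten (x : W) : herm x (e 10) = theta * x 9 := by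
  simp [herm_e, gram, Fin.sum_univ_succ, conj_theta]; try ring

lemma eq_zero_of_herm_e {x : W} (h : ∀ i, herm x (e i) = 0) : x = 0 := by
  have ht := theta_ne_zero
  have h0 := h 0; have h1 := h 1; have h2 := h 2; have h3 := h 3; have h4 := h 4; have h5 := h 5
  have h6 := h 6; have h7 := h 7; have h8 := h 8; have h9 := h 9; have h10 := h 10
  rw [herm_e_zero] at h0
  rw [herm_e_one] at h1
  rw [herm_e_two] at h2
  rw [herm_e_three] at h3
  rw [herm_e_four] at h4
  rw [herm_e_five] at h5
  rw [herm_e_six] at h6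
  rw [herm_e_seven] at h7
  rw [herm_e_eight] at h8
  rw [herm_e_nine] at h9
  rw [herm_e_ten] at h10
  have tt := theta_sq
  -- each block `B` is eliminated from its last row upwards
  have block : ∀ p q r s : ℂ, 3 * p - theta * q = 0 → theta * p + 3 * q - theta * r = 0 →
      theta * q + 3 * r - theta * s = 0 → theta * r + 3 * s = 0 →
      p = 0 ∧ q = 0 ∧ r = 0 ∧ s = 0 := by
    intro p q r s e1 e2 e3 e4
    have d1 : r = theta * s := mul_left_cancel₀ ht (by linear_combination e4 - s * tt)
    have d2 : q = -2 * s :=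
      mul_left_cancel₀ ht (by rw [d1] at e3; linear_combination e3)
    have d3 : p = -theta * s :=
      mul_left_cancel₀ ht (by rw [d1, d2] at e2; linear_combination e2 + 2 * s * tt)
    have d4 : s = 0 := mul_left_cancel₀ ht (by rw [d2, d3] at e1; linear_combination -e1)
    simp [d1, d2, d3, d4]
  obtain ⟨x1, x2, x3, x4⟩ := block _ _ _ _ h1 h2 h3 h4
  obtain ⟨x5, x6, x7, x8⟩ := block _ _ _ _ h5 h6 h7 h8
  have x0 : x 0 = 0 := by simpa using h0
  have x9 : x 9 = 0 := by simpa [ht] using h10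
  have x10 : x 10 = 0 := by simpa [ht] using h9
  ext i
  fin_cases i
  exacts [x0, x1, x2, x3, x4, x5, x6, x7, x8, x9, x10]

lemma det_gram_ne_zero : gram.det ≠ 0 := by
  intro h
  obtain ⟨v, hv, hv0⟩ := Matrix.exists_vecMul_eq_zero_iff.mpr h
  refine hv (eq_zero_of_herm_e fun i => ?_)
  have := congrFun hv0 i
  simp only [Matrix.vecMul, dotProduct, Pi.zero_apply] at this
  rw [herm_e, ← this]
  exact Finset.sum_congr rfl fun j _ => mul_comm _ _

/-- The lattice `Λ` as a subgroup of `ℂ¹¹`. -/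
def lattice : AddSubgroup W where
  carrier := {v | ∀ i, v i ∈ Eis}
  add_mem' hv hw i := add_mem (hv i) (hw i)
  zero_mem' _ := zero_mem _
  neg_mem' hv i := neg_mem (hv i)

lemma mem_lattice {v : W} : v ∈ lattice ↔ ∀ i, v i ∈ Eis := Iff.rfl

lemma smul_mem_lattice {c : ℂ} (hc : c ∈ Eis) {v : W} (hv : v ∈ lattice) : c • v ∈ lattice :=
  fun i => mul_mem hc (hv i)

lemma toC_mem (x : Lam) : toC x ∈ lattice := fun i => (x i).2

lemma exists_toC {v : W} (hv : v ∈ lattice) : ∃ x : Lam, toC x = v :=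
  ⟨fun i => ⟨v i, hv i⟩, rfl⟩

lemma e_mem (i : Fin 11) : e i ∈ lattice := by
  intro j
  by_cases h : j = i
  · subst h; simp [e, one_mem]
  · simp [e, h, zero_mem]

lemma eq_sum_e (x : W) : x = ∑ i, x i • e i := by
  ext j
  simp [e, Pi.single_apply]

/-- The form takes values in `θℰ` on the lattice. -/
lemma exists_herm_eq {x y : W} (hx : x ∈ lattice) (hy : y ∈ lattice) :
    ∃ z ∈ Eis, herm x y = theta * z := by
  have hbasis : ∀ i, ∃ z ∈ Eis, herm x (e i) = theta * z := by
    have t := theta_mem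
    have tt := theta_sq
    have h := fun i => mem_lattice.mp hx i
    intro i
    fin_cases i
    · exact ⟨-theta * x 0, mul_mem (neg_mem t) (h 0), by
        simp [herm_e_zero]; linear_combination x 0 * tt⟩
    · exact ⟨-theta * x 1 - x 2, sub_mem (mul_mem (neg_mem t) (h 1)) (h 2), by
        simp [herm_e_one]; linear_combination x 1 * tt⟩
    · exact ⟨x 1 - theta * x 2 - x 3, sub_mem (sub_mem (h 1) (mul_mem t (h 2))) (h 3), by
        simp [herm_e_two]; linear_combination x 2 * tt⟩
    · exact ⟨x 2 - theta * x 3 - x 4, sub_mem (sub_mem (h 2) (mul_mem t (h 3))) (h 4), by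
        simp [herm_e_three]; linear_combination x 3 * tt⟩
    · exact ⟨x 3 - theta * x 4, sub_mem (h 3) (mul_mem t (h 4)), by
        simp [herm_e_four]; linear_combination x 4 * tt⟩
    · exact ⟨-theta * x 5 - x 6, sub_mem (mul_mem (neg_mem t) (h 5)) (h 6), by
        simp [herm_e_five]; linear_combination x 5 * tt⟩
    · exact ⟨x 5 - theta * x 6 - x 7, sub_mem (sub_mem (h 5) (mul_mem t (h 6))) (h 7), by
        simp [herm_e_six]; linear_combination x 6 * tt⟩
    · exact ⟨x 6 - theta * x 7 - x 8, sub_mem (sub_mem (h 6) (mul_mem t (h 7))) (h 8), by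
        simp [herm_e_seven]; linear_combination x 7 * tt⟩
    · exact ⟨x 7 - theta * x 8, sub_mem (h 7) (mul_mem t (h 8)), by
        simp [herm_e_eight]; linear_combination x 8 * tt⟩
    · exact ⟨-x 10, neg_mem (h 10), by simp [herm_e_nine]⟩
    · exact ⟨x 9, h 9, by simp [herm_e_ten]⟩
  choose z hz hze using hbasis
  refine ⟨∑ i, conj (y i) * z i, sum_mem fun i _ => mul_mem (conj_mem (hy i)) (hz i), ?_⟩
  conv_lhs => rw [eq_sum_e y]
  rw [← conj_herm, ← hermL_apply, map_sum, map_sum, Finset.mul_sum]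
  refine Finset.sum_congr rfl fun i _ => ?_
  rw [hermL_apply, conj_herm, herm_smul_right, hze]
  ring

/-- Norms of lattice vectors lie in `3ℤ`, being real elements of `θℰ`. -/
lemma exists_herm_self {x : W} (hx : x ∈ lattice) : ∃ j : ℤ, herm x x = 3 * j := by
  obtain ⟨z, hz, h⟩ := exists_herm_eq hx hx
  obtain ⟨u, v, rfl⟩ := mem_Eis.mp hz
  have hr := conj_herm x x
  rw [h] at hr
  simp only [map_mul, map_add, conj_theta, conj_omega, map_intCast] at hr
  have h0 : ((2 * u - v : ℤ) : ℂ) + (0 : ℤ) * omega = 0 := by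
    push_cast
    exact mul_left_cancel₀ theta_ne_zero (by linear_combination -hr)
  have hv : v = 2 * u := by linarith [(omega_coord h0).1]
  refine ⟨-u, ?_⟩
  rw [h, hv]
  push_cast
  linear_combination (u : ℂ) * theta_sq - theta * u * theta_eq

/-! ### Isometries of the lattice -/

lemma extend_mulVec_mem (g : Gamma) {v : W} (hv : v ∈ lattice) :
    (extend g : Matrix (Fin 11) (Fin 11) ℂ) *ᵥ v ∈ lattice := by
  obtain ⟨x, rfl⟩ := exists_toC hv
  rw [← toC_mulVec]
  exact toC_mem _

/-- An isometry of `ℂ¹¹` which maps `Λ` into itself is induced by an element of `Γ`: its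
determinant `d` is an Eisenstein integer with `d d̄ = 1`, as the form is nondegenerate. -/
lemma exists_gamma (φ : W →ₗ[ℂ] W) (hφ : ∀ x y, herm (φ x) (φ y) = herm x y)
    (hL : ∀ i, φ (e i) ∈ lattice) :
    ∃ g : Gamma, ∀ x, (extend g : Matrix (Fin 11) (Fin 11) ℂ) *ᵥ x = φ x := by
  set A : Matrix (Fin 11) (Fin 11) Eis := fun i j => ⟨φ (e j) i, hL j i⟩
  set A' : Matrix (Fin 11) (Fin 11) ℂ := A.map Eis.subtype with hA'
  have hmul : ∀ x, A' *ᵥ x = φ x := by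
    intro x
    conv_rhs => rw [eq_sum_e x, map_sum]
    ext i
    simp only [Matrix.mulVec, dotProduct, Finset.sum_apply, map_smul, Pi.smul_apply, smul_eq_mul]
    exact Finset.sum_congr rfl fun j _ => mul_comm _ _
  have key : A'ᵀ * gram * A'.map star = gram := by
    ext i j
    have h := hφ (e i) (e j)
    rw [← hmul, ← hmul, gram_conj, herm_eq] at h
    simpa [e, ← Pi.single_star] using h
  have hstar : A'.map star = (A.map conjE).map Eis.subtype := rfl
  have hdet := congrArg Matrix.det key
  rw [hstar, Matrix.det_mul, Matrix.det_mul, Matrix.det_transpose, hA', ← RingHom.mapMatrix_apply,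
    ← RingHom.map_det, ← RingHom.mapMatrix_apply, ← RingHom.map_det] at hdet
  have hunit : A.det * (A.map conjE).det = 1 := by
    apply Subtype.ext
    refine mul_left_cancel₀ det_gram_ne_zero ?_
    push_cast
    rw [mul_one]
    conv_rhs => rw [← hdet]
    simp only [Subring.subtype_apply]
    ring
  have hu : IsUnit A := (Matrix.isUnit_iff_isUnit_det _).mpr (IsUnit.of_mul_eq_one _ hunit)
  obtain ⟨u, hu⟩ := hu
  have hC : ∀ x : Lam, toC (A *ᵥ x) = φ (toC x) := by
    intro x
    rw [← hmul]
    ext i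
    simp [toC, A', Matrix.mulVec, dotProduct]
  refine ⟨⟨u, fun x y => ?_⟩, fun x => ?_⟩
  · rw [ip, hu, hC, hC, hφ, ip]
  · rw [← hmul]
    change (u : Matrix (Fin 11) (Fin 11) Eis).map Eis.subtype *ᵥ x = _
    rw [hu]

/-- Two vectors of `ℂ¹¹` are equivalent if an element of `Γ` maps the first to the second. -/
def GammaEquiv (r r' : W) : Prop := ∃ g : Gamma, (extend g : Matrix (Fin 11) (Fin 11) ℂ) *ᵥ r = r'

lemma GammaEquiv.trans {r r' r'' : W} (h : GammaEquiv r r') (h' : GammaEquiv r' r'') :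
    GammaEquiv r r'' := by
  obtain ⟨g, rfl⟩ := h
  obtain ⟨g', rfl⟩ := h'
  exact ⟨g' * g, by rw [map_mul, Units.val_mul, Matrix.mulVec_mulVec]⟩

lemma GammaEquiv.refl (r : W) : GammaEquiv r r := ⟨1, by simp⟩

lemma GammaEquiv.neg (r : W) : GammaEquiv r (-r) := by
  obtain ⟨g, hg⟩ := exists_gamma (-LinearMap.id)
    (fun x y => by simp [herm_neg_left, herm_neg_right]) (fun i => by simpa using e_mem i)
  exact ⟨g, by simp [hg]⟩

lemma GammaEquiv.mem {r r' : W} (h : GammaEquiv r r') (hr : r ∈ lattice) : r' ∈ lattice := by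
  obtain ⟨g, rfl⟩ := h
  exact extend_mulVec_mem g hr

lemma herm_e_nine_left (x : W) : herm (e 9) x = theta * conj (x 10) := by
  rw [← conj_herm, herm_e_nine, map_mul, map_neg, conj_theta, neg_neg]

lemma herm_e_ten_left (x : W) : herm (e 10) x = -theta * conj (x 9) := by
  rw [← conj_herm, herm_e_ten, map_mul, conj_theta]

/-- The summand `K = (3) ⊕ B ⊕ B` of `Λ`: the orthogonal complement in `Λ` of the hyperbolic plane
spanned by `e 9` and `e 10`. -/
def K : AddSubgroup W where
  carrier := {v | v ∈ lattice ∧ v 9 = 0 ∧ v 10 = 0}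
  add_mem' hv hw := ⟨add_mem hv.1 hw.1, by simp [hv.2.1, hw.2.1], by simp [hv.2.2, hw.2.2]⟩
  zero_mem' := ⟨zero_mem _, rfl, rfl⟩
  neg_mem' hv := ⟨neg_mem hv.1, by simp [hv.2.1], by simp [hv.2.2]⟩

lemma smul_mem_K {c : ℂ} (hc : c ∈ Eis) {v : W} (hv : v ∈ K) : c • v ∈ K :=
  ⟨smul_mem_lattice hc hv.1, by simp [hv.2.1], by simp [hv.2.2]⟩

@[simp] lemma e_nine_nine : e 9 9 = 1 := by simp [e]
@[simp] lemma e_nine_ten : e 9 10 = 0 := by simp [e]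
@[simp] lemma e_ten_nine : e 10 9 = 0 := by simp [e]
@[simp] lemma e_ten_ten : e 10 10 = 1 := by simp [e]

lemma sub_mem_K {x : W} (hx : x ∈ lattice) : x - x 9 • e 9 - x 10 • e 10 ∈ K :=
  ⟨sub_mem (sub_mem hx (smul_mem_lattice (hx 9) (e_mem 9))) (smul_mem_lattice (hx 10) (e_mem 10)),
    by simp, by simp⟩

/-- Eichler transvections: the isometry fixing `e 10` and sending `e 9` to the isotropic vector
`e 9 + l + τ e 10`, for `l ∈ K`. -/
lemma exists_transvection {l : W} (hl : l ∈ K) {τ : ℂ} (hτ : τ ∈ Eis)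
    (h : herm l l = theta * (τ - conj τ)) (x : W) :
    GammaEquiv x (x + x 9 • l + (herm x l / theta + x 9 * τ) • e 10) := by
  have ht := theta_ne_zero
  set φ : W →ₗ[ℂ] W := LinearMap.id + (LinearMap.proj 9).smulRight l +
    (theta⁻¹ • hermL l + τ • LinearMap.proj 9).smulRight (e 10)
  have hφx : ∀ x, φ x = x + x 9 • l + (herm x l / theta + x 9 * τ) • e 10 := by
    intro x
    simp [φ, div_eq_inv_mul, mul_comm τ]
  obtain ⟨g, hg⟩ := exists_gamma φ (fun x y => by
    rw [hφx, hφx]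
    simp only [herm_add_left, herm_add_right, herm_smul_left, herm_smul_right, herm_e_ten,
      Pi.add_apply, Pi.smul_apply, smul_eq_mul,
      herm_e_ten_left, hl.2.1, e_ten_nine, map_add, map_mul, map_div₀, conj_theta, conj_herm, h,
      map_zero]
    field_simp
    ring) (fun i => by
    rw [hφx]
    obtain ⟨z, hz, hze⟩ := exists_herm_eq (e_mem i) hl.1
    rw [hze, mul_div_cancel_left₀ _ ht]
    exact add_mem (add_mem (e_mem i) (smul_mem_lattice (e_mem i 9) hl.1))
      (smul_mem_lattice (add_mem hz (mul_mem (e_mem i 9) hτ)) (e_mem 10)))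
  exact ⟨g, by rw [hg, hφx]⟩

/-- Every `l ∈ K` occurs in an Eichler transvection. -/
lemma exists_transvection_param {l : W} (hl : l ∈ K) :
    ∃ τ ∈ Eis, herm l l = theta * (τ - conj τ) := by
  obtain ⟨j, hj⟩ := exists_herm_self hl.1
  refine ⟨-j * omega, mul_mem (neg_mem (intCast_mem _ _)) omega_mem, ?_⟩
  simp only [map_mul, map_neg, map_intCast, conj_omega]
  rw [hj]
  linear_combination (j : ℂ) * theta_sq - (j : ℂ) * theta * theta_eq

/-- The isometry `e 9 ↦ e 10 ↦ -e 9`, which is the identity on `K`. -/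
lemma exists_swap (x : W) :
    GammaEquiv x (x + (-x 10 - x 9) • e 9 + (x 9 - x 10) • e 10) := by
  set φ : W →ₗ[ℂ] W := LinearMap.id +
    (-(LinearMap.proj 10 : W →ₗ[ℂ] ℂ) - LinearMap.proj 9).smulRight (e 9) +
    ((LinearMap.proj 9 : W →ₗ[ℂ] ℂ) - LinearMap.proj 10).smulRight (e 10)
  have hφx : ∀ x, φ x = x + (-x 10 - x 9) • e 9 + (x 9 - x 10) • e 10 := by
    intro x
    simp [φ]
  obtain ⟨g, hg⟩ := exists_gamma φ (fun x y => by
    rw [hφx, hφx]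
    simp only [herm_add_left, herm_add_right, herm_smul_left, herm_smul_right, herm_e_ten,
      Pi.add_apply, Pi.smul_apply, smul_eq_mul,
      herm_e_ten_left, herm_e_nine, herm_e_nine_left, e_ten_nine, e_ten_ten, e_nine_nine,
      e_nine_ten, map_sub, map_neg]
    ring) (fun i => by
    rw [hφx]
    have h9 := e_mem i 9
    have h10 := e_mem i 10
    exact add_mem (add_mem (e_mem i) (smul_mem_lattice (sub_mem (neg_mem h10) h9) (e_mem 9)))
      (smul_mem_lattice (sub_mem h9 h10) (e_mem 10)))
  exact ⟨g, by rw [hg, hφx]⟩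

/-- The rational isometry `x ↦ x - ⟨x, s⟩ / (θ η δ) s`, where `s = r - k₀`, maps `r` to `k₀`. It
need not preserve `Λ`, but it maps `Λ` to the lattice `K ⊕ (δ⁻¹ e 9, δ̄ e 10)`, and composing it
with the map `e 9 ↦ δ e 9`, `e 10 ↦ δ̄⁻¹ e 10` gives an element of `Γ`. -/
lemma gammaEquiv_of_congruence {r k₀ κ : W} {η δ a b w : ℂ} (hk₀ : k₀ ∈ K) (hκ : κ ∈ K)
    (h3 : herm k₀ k₀ = 3) (hη0 : η ≠ 0) (hη : η ∈ Eis)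
    (hηc : conj η = η ∨ conj η = -η) (hδ : δ ∈ Eis) (hδ0 : δ ≠ 0) (ha : a ∈ Eis) (hb : b ∈ Eis)
    (hw : w ∈ Eis) (hr : r = k₀ + δ • κ + (η * a) • e 9 + (δ * η * b) • e 10)
    (hrr : herm r r = 3) (hκ₀ : herm κ k₀ = -(theta * η))
    (hκL : ∀ m ∈ lattice, ∃ z ∈ Eis, herm m κ = theta * η * z)
    (hab : 1 + conj η * conj a * b = conj δ * w) : GammaEquiv r k₀ := by
  have ht := theta_ne_zero
  have hδc : conj δ ≠ 0 := (map_ne_zero _).mpr hδ0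
  set ν := theta * η with hν
  have hν0 : ν ≠ 0 := mul_ne_zero ht hη0
  set s := δ • κ + (η * a) • e 9 + (δ * η * b) • e 10 with hs
  have hrs : r = k₀ + s := by rw [hr, hs]; abel
  have hsk : herm s k₀ = -(δ * ν) := by
    rw [hs]
    simp only [herm_add_left, herm_smul_left, hκ₀, herm_e_nine_left, herm_e_ten_left, hk₀.2.1,
      hk₀.2.2, map_zero]
    ring
  have hks : herm k₀ s = -conj (δ * ν) := by rw [← conj_herm, hsk, map_neg]
  have hss : herm s s = δ * ν + conj (δ * ν) := by
    have h := hrr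
    rw [hrs] at h
    simp only [herm_add_left, herm_add_right, h3, hsk, hks] at h
    linear_combination h
  have hrs' : herm r s = δ * ν := by
    rw [hrs, herm_add_left, hks, hss]; ring
  have hs9 : s 9 = η * a := by simp [hs, hκ.2.1]
  have hs10 : s 10 = δ * η * b := by simp [hs, hκ.2.2]
  set φ₁ : W →ₗ[ℂ] W := LinearMap.id - ((δ * ν)⁻¹ • hermL s).smulRight s
  have hφ₁x : ∀ x, φ₁ x = x - (herm x s / (δ * ν)) • s := by
    intro x
    simp [φ₁, div_eq_inv_mul]
  set φ₂ : W →ₗ[ℂ] W := LinearMap.id + ((δ - 1) • LinearMap.proj 9).smulRight (e 9) +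
    (((conj δ)⁻¹ - 1) • LinearMap.proj 10).smulRight (e 10)
  have hφ₂x : ∀ x, φ₂ x = x + ((δ - 1) * x 9) • e 9 + (((conj δ)⁻¹ - 1) * x 10) • e 10 := by
    intro x
    simp [φ₂]
  have iso₁ : ∀ x y, herm (φ₁ x) (φ₁ y) = herm x y := by
    intro x y
    rw [hφ₁x, hφ₁x]
    have hy : herm s y = conj (herm y s) := (conj_herm y s).symm
    have hνc : conj (δ * ν) ≠ 0 := (map_ne_zero _).mpr (mul_ne_zero hδ0 hν0)
    have hνd : δ * ν ≠ 0 := mul_ne_zero hδ0 hν0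
    simp only [herm_sub_left, herm_sub_right, herm_smul_left, herm_smul_right, map_div₀, hss, hy]
    generalize δ * ν = N at *
    field_simp
    ring
  have iso₂ : ∀ x y, herm (φ₂ x) (φ₂ y) = herm x y := by
    intro x y
    rw [hφ₂x, hφ₂x]
    simp only [herm_add_left, herm_add_right, herm_smul_left, herm_smul_right, herm_e_ten,
      Pi.add_apply, Pi.smul_apply, smul_eq_mul,
      herm_e_ten_left, herm_e_nine, herm_e_nine_left, e_ten_nine, e_ten_ten, e_nine_nine,
      e_nine_ten, map_sub, map_mul, map_one, map_inv₀, Complex.conj_conj]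
    field_simp
    ring
  have hmem : ∀ x ∈ lattice, φ₂ (φ₁ x) ∈ lattice := by
    intro x hx
    obtain ⟨z, hz, hxz⟩ := hκL x hx
    obtain ⟨c, hc⟩ : ∃ c, c = herm x s / ν := ⟨_, rfl⟩
    have hcx : herm x s / (δ * ν) = c / δ := by rw [hc]; field_simp
    have hform : φ₂ (φ₁ x) = (x - x 9 • e 9 - x 10 • e 10) - c • κ +
        (δ * x 9 - c * (η * a)) • e 9 + ((x 10 - c * (η * b)) / conj δ) • e 10 := by
      rw [hφ₂x, hφ₁x, hcx]
      simp only [Pi.sub_apply, Pi.smul_apply, smul_eq_mul, hs9, hs10]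
      rw [hs]
      match_scalars <;> field_simp <;> ring
    -- `ε = ± 1` is the sign with `η̄ = ε η`
    obtain ⟨ε, hε, hηε⟩ : ∃ ε ∈ Eis, conj η = ε * η := by
      rcases hηc with h | h
      · exact ⟨1, one_mem _, by rw [h, one_mul]⟩
      · exact ⟨-1, neg_mem (one_mem _), by rw [h, neg_one_mul]⟩
    have hce : c = conj δ * z + ε * (conj δ * conj b * x 9 - x 10 * conj a) := by
      rw [hc, hs]
      simp only [herm_add_right, herm_smul_right, hxz, herm_e_nine, herm_e_ten, map_mul, hηε]
      rw [hν]
      field_simp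
      ring
    have hcm : c ∈ Eis := by
      rw [hce]
      exact add_mem (mul_mem (conj_mem hδ) hz) (mul_mem hε (sub_mem
        (mul_mem (mul_mem (conj_mem hδ) (conj_mem hb)) (hx 9)) (mul_mem (hx 10) (conj_mem ha))))
    have hq : (x 10 - c * (η * b)) / conj δ =
        x 10 * w - (z + ε * (conj b * x 9)) * (η * b) := by
      rw [div_eq_iff hδc, hce]
      rw [hηε] at hab
      linear_combination x 10 * hab
    rw [hform, hq]
    refine add_mem (add_mem (sub_mem (sub_mem_K hx).1 (smul_mem_lattice hcm hκ.1)) ?_) ?_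
    · exact smul_mem_lattice (sub_mem (mul_mem hδ (hx 9)) (mul_mem hcm (mul_mem hη ha))) (e_mem 9)
    · exact smul_mem_lattice (sub_mem (mul_mem (hx 10) hw) (mul_mem (add_mem hz (mul_mem hε
        (mul_mem (conj_mem hb) (hx 9)))) (mul_mem hη hb))) (e_mem 10)
  obtain ⟨g, hg⟩ := exists_gamma (φ₂ ∘ₗ φ₁)
    (fun x y => by rw [LinearMap.comp_apply, LinearMap.comp_apply, iso₂, iso₁])
    (fun i => hmem _ (e_mem i))
  refine ⟨g, ?_⟩
  rw [hg, LinearMap.comp_apply, hφ₁x, hrs', div_self (mul_ne_zero hδ0 hν0), one_smul, hrs,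
    add_sub_cancel_right, hφ₂x, hk₀.2.1, hk₀.2.2]
  simp

/-! ### Reduction of roots -/

/-- Vectors `r ∈ Λ` of norm `3` with `⟨r, Λ⟩ = θ η ℰ`. The nodal roots are the case `η = 1`, the
chordal roots the case `η = θ`. -/
structure IsRoot (η : Eis) (r : W) : Prop where
  mem : r ∈ lattice
  norm : herm r r = 3
  exists_eq : ∀ x ∈ lattice, ∃ z : Eis, herm r x = theta * η * z
  exists_unit : ∃ x ∈ lattice, herm r x = theta * η

lemma IsRoot.of_equiv {η : Eis} {r r' : W} (hr : IsRoot η r) (h : GammaEquiv r r') :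
    IsRoot η r' := by
  refine ⟨h.mem hr.mem, ?_, fun x hx => ?_, ?_⟩ <;> obtain ⟨g, rfl⟩ := h
  · rw [herm_extend, hr.norm]
  · obtain ⟨z, hz⟩ := hr.exists_eq _ (extend_mulVec_mem g⁻¹ hx)
    refine ⟨z, ?_⟩
    rw [← hz, ← herm_extend g r, Matrix.mulVec_mulVec, ← Units.val_mul, ← map_mul, mul_inv_cancel,
      map_one, Units.val_one, Matrix.one_mulVec]
  · obtain ⟨x, hx, hxe⟩ := hr.exists_unit
    exact ⟨_, extend_mulVec_mem g hx, by rw [herm_extend, hxe]⟩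

lemma IsRoot.exists_nine {η : Eis} {r : W} (hr : IsRoot η r) : ∃ a : Eis, r 9 = η * a := by
  obtain ⟨z, hz⟩ := hr.exists_eq _ (e_mem 10)
  exact ⟨z, mul_left_cancel₀ theta_ne_zero (by rw [← herm_e_ten, hz, mul_assoc])⟩

lemma IsRoot.exists_ten {η : Eis} {r : W} (hr : IsRoot η r) : ∃ b : Eis, r 10 = η * b := by
  obtain ⟨z, hz⟩ := hr.exists_eq _ (e_mem 9)
  rw [herm_e_nine] at hz
  exact ⟨-z, mul_left_cancel₀ theta_ne_zero (by push_cast; linear_combination -hz)⟩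

/-- The decomposition of the second argument along `Λ = K ⊕ ⟨e 9, e 10⟩`. -/
lemma herm_eq_herm_sub (r x : W) :
    herm r x = herm r (x - x 9 • e 9 - x 10 • e 10) - theta * conj (x 9) * r 10 +
      theta * conj (x 10) * r 9 := by
  simp only [herm_sub_right, herm_smul_right, herm_e_nine, herm_e_ten]
  ring

lemma IsRoot.exists_nine_ne_zero {η : Eis} (hη : η ≠ 0) {r : W} (hr : IsRoot η r) :
    ∃ r', GammaEquiv r r' ∧ r' 9 ≠ 0 := by
  have ht := theta_ne_zero
  have hη' : (η : ℂ) ≠ 0 := fun h => hη (Subtype.ext h)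
  by_cases h9 : r 9 = 0
  · by_cases h10 : r 10 = 0
    · obtain ⟨x, hx, hxe⟩ := hr.exists_unit
      rw [herm_eq_herm_sub, h9, h10, mul_zero, mul_zero, sub_zero, add_zero] at hxe
      have hl := sub_mem_K hx
      set l := x - x 9 • e 9 - x 10 • e 10
      obtain ⟨τ, hτ, h⟩ := exists_transvection_param hl
      refine ⟨_, (exists_transvection hl hτ h r).trans (exists_swap _), ?_⟩
      simp [h9, h10, hxe, ht, hη']
    · exact ⟨_, exists_swap r, by simp [h10]⟩
  · exact ⟨r, GammaEquiv.refl r, h9⟩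

/-- An Eichler transvection along `l ∈ K` changes `b = r 10 / η` modulo `a = r 9 / η` by
`⟨r, l⟩ / (θ η)`, so `a` and `b` can be made coprime. -/
lemma IsRoot.exists_isCoprime {η : Eis} (hη : η ≠ 0) {r : W} (hr : IsRoot η r) (h9 : r 9 ≠ 0) :
    ∃ r', GammaEquiv r r' ∧ ∃ a b : Eis, r' 9 = η * a ∧ r' 10 = η * b ∧ IsCoprime a b := by
  have ht := theta_ne_zero
  have hη' : (η : ℂ) ≠ 0 := fun h => hη (Subtype.ext h)
  have hν : theta * η ≠ 0 := mul_ne_zero ht hη'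
  obtain ⟨a, ha⟩ := hr.exists_nine
  obtain ⟨b, hb⟩ := hr.exists_ten
  have ha0 : a ≠ 0 := by rintro rfl; simp [ha] at h9
  -- the ideal of the values `⟨r, l⟩ / (θ η)`, `l ∈ K`
  set I : Ideal Eis :=
    { carrier := {z | ∃ l ∈ K, herm r l = theta * η * z}
      add_mem' := by
        rintro z z' ⟨l, hl, h⟩ ⟨l', hl', h'⟩
        exact ⟨l + l', add_mem hl hl', by rw [herm_add_right, h, h']; push_cast; ring⟩
      zero_mem' := ⟨0, zero_mem _, by simp⟩
      smul_mem' := by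
        rintro c z ⟨l, hl, h⟩
        refine ⟨conj (c : ℂ) • l, smul_mem_K (conj_mem c.2) hl, ?_⟩
        rw [herm_smul_right, h, Complex.conj_conj, smul_eq_mul]
        push_cast
        ring }
  obtain ⟨z, ⟨l, hl, hz⟩, hc⟩ := exists_isCoprime_add I b ha0 (by
    obtain ⟨x, hx, hxe⟩ := hr.exists_unit
    obtain ⟨z, hz⟩ := hr.exists_eq _ (sub_mem_K hx).1
    refine ⟨⟨conj (x 10), conj_mem (hx 10)⟩, -⟨conj (x 9), conj_mem (hx 9)⟩, z,
      ⟨_, sub_mem_K hx, hz⟩, Subtype.ext (mul_left_cancel₀ hν ?_)⟩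
    rw [herm_eq_herm_sub, hz, ha, hb] at hxe
    push_cast
    linear_combination hxe)
  obtain ⟨τ, hτ, h⟩ := exists_transvection_param hl
  refine ⟨_, exists_transvection hl hτ h r, a, b + z + a * ⟨τ, hτ⟩, ?_, ?_,
    hc.add_mul_left_right _⟩
  · simp [hl.2.1, ha]
  · simp only [Pi.add_apply, Pi.smul_apply, smul_eq_mul, hl.2.2, e_ten_ten, hz, ha, hb]
    push_cast
    field_simp
    ring

/-- Used to choose between a root `r` and `-r`: passing to `-r` replaces `δ` by `-2 - δ` for chordal
roots. -/
lemma isCoprime_theta_or (δ : Eis) :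
    IsCoprime (⟨theta, theta_mem⟩ : Eis) δ ∨ IsCoprime (⟨theta, theta_mem⟩ : Eis) (-2 - δ) := by
  have ht : (⟨theta, theta_mem⟩ : Eis) * ⟨theta, theta_mem⟩ = -3 := Subtype.ext theta_sq
  set t : Eis := ⟨theta, theta_mem⟩
  -- modulo `θ`, every Eisenstein integer is congruent to a rational integer
  have key : ∀ (s : ℤ) (c : Eis), ¬ (3 : ℤ) ∣ s → IsCoprime t (s + t * c) := by
    intro s c hs
    refine IsCoprime.add_mul_left_right ?_ c
    obtain ⟨u, v, huv⟩ := (Int.prime_three.irreducible.coprime_iff_not_dvd).mpr hs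
    refine ⟨-(u : Eis) * t, v, ?_⟩
    have := congrArg (Int.cast : ℤ → Eis) huv
    push_cast at this
    linear_combination this - (u : Eis) * ht
  obtain ⟨x, y, h⟩ := mem_Eis.mp δ.2
  have hδ : δ = ((x + y : ℤ) : Eis) + t * ((y : Eis) * (1 + ⟨omega, omega_mem⟩)) := by
    apply Subtype.ext
    rw [h]
    push_cast
    change (x : ℂ) + y * omega = (x + y) + theta * (y * (1 + omega))
    rw [theta_eq]
    linear_combination -2 * (y : ℂ) * omega_sq
  by_cases hs : (3 : ℤ) ∣ x + y
  · right
    have : -2 - δ = ((-2 - (x + y) : ℤ) : Eis) +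
        t * (-((y : Eis) * (1 + ⟨omega, omega_mem⟩))) := by
      rw [hδ]; push_cast; ring
    rw [this]
    exact key _ _ (by omega)
  · left
    rw [hδ]
    exact key _ _ hs

/-- The two cases `η = 1` (nodal roots) and `η = θ` (chordal roots). -/
def IsRootType (η : Eis) : Prop := η = 1 ∨ η = ⟨theta, theta_mem⟩

lemma IsRootType.ne_zero {η : Eis} (h : IsRootType η) : η ≠ 0 := by
  rcases h with rfl | rfl
  · exact one_ne_zero
  · exact fun h => theta_ne_zero (congrArg Subtype.val h)

lemma IsRootType.conj_eq {η : Eis} (h : IsRootType η) :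
    conj (η : ℂ) = η ∨ conj (η : ℂ) = -η := by
  rcases h with rfl | rfl
  · left; simp
  · right; exact conj_theta

/-- The condition that `θ η Y` has trace in `3 D ℤ` determines `Y` modulo `D` up to a rational
integer multiple of `η̄`. -/
lemma IsRootType.exists_eq_add {η : Eis} (h : IsRootType η) {Y : ℂ} (hY : Y ∈ Eis) {D j : ℤ}
    (e : theta * η * Y + conj (theta * η * Y) = 3 * D * j) :
    ∃ u : ℤ, ∃ q ∈ Eis, Y = u * conj (η : ℂ) + D * q := by
  obtain ⟨x, y, rfl⟩ := mem_Eis.mp hY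
  have t := theta_sq
  have te := theta_eq
  rcases h with rfl | rfl
  · refine ⟨x, -j * omega, mul_mem (neg_mem (intCast_mem _ _)) omega_mem, ?_⟩
    simp only [map_mul, map_add, map_one, map_intCast, conj_theta, conj_omega, OneMemClass.coe_one]
      at e ⊢
    have : (y : ℂ) = -D * j := by
      linear_combination (-1 / 3 : ℂ) * e + y / 3 * t - y / 3 * theta * te
    rw [this]; ring
  · refine ⟨-x, j * omega, mul_mem (intCast_mem _ _) omega_mem, ?_⟩
    simp only [map_mul, map_add, map_intCast, conj_theta, conj_omega] at e ⊢
    have : (y : ℂ) = 2 * x + D * j := by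
      linear_combination (1 / 3 : ℂ) * e - (2 * x - y) / 3 * t
    push_cast
    rw [this, te]
    ring

/-- Up to `Γ`, the norms of `a = r 9 / η` and of `δ = (3 - ⟨r, k₀⟩) / (θ η)` are coprime. -/
lemma IsRoot.exists_coprime_nrm {η : Eis} (hη : IsRootType η) {r k₀ : W} (hr : IsRoot η r)
    (hk₀ : IsRoot η k₀) (hK : k₀ ∈ K) :
    ∃ r', GammaEquiv r r' ∧ ∃ a δ : Eis, r' 9 = η * a ∧ δ ≠ 0 ∧ IsCoprime η δ ∧
      3 - herm r' k₀ = theta * η * δ ∧ Nat.Coprime (nrm a) (nrm δ) := by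
  have hk₀9 := hK.2.1
  have hk₀10 := hK.2.2
  obtain ⟨r₁, h₁, h9⟩ := hr.exists_nine_ne_zero hη.ne_zero
  obtain ⟨r₂, h₂, a, b, ha, hb, hab⟩ := (hr.of_equiv h₁).exists_isCoprime hη.ne_zero h9
  have h12 := h₁.trans h₂
  have hr₂ := hr.of_equiv h12
  obtain ⟨ζ, hζ⟩ : ∃ ζ : Eis, 3 - herm r₂ k₀ = theta * η * ζ := by
    obtain ⟨z, hz⟩ := hr₂.exists_eq _ hK.1
    obtain ⟨w, hw⟩ := hk₀.exists_eq _ hK.1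
    rw [hk₀.norm] at hw
    exact ⟨w - z, by rw [hz, hw]; push_cast; ring⟩
  -- replacing `r` by `-r` if necessary makes `δ` nonzero and coprime to `η`
  obtain ⟨r₃, h₃, a, b, δ, ha, hb, hab, hδ0, hδη, hδ⟩ : ∃ r', GammaEquiv r r' ∧ ∃ a b δ : Eis,
      r' 9 = η * a ∧ r' 10 = η * b ∧ IsCoprime a b ∧ δ ≠ 0 ∧ IsCoprime η δ ∧
      3 - herm r' k₀ = theta * η * δ := by
    have neg : ∀ δ : Eis, δ ≠ 0 → IsCoprime η δ → 3 + herm r₂ k₀ = theta * η * δ →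
        ∃ r', GammaEquiv r r' ∧ ∃ a b δ : Eis,
      r' 9 = η * a ∧ r' 10 = η * b ∧ IsCoprime a b ∧ δ ≠ 0 ∧ IsCoprime η δ ∧
      3 - herm r' k₀ = theta * η * δ := fun δ h0 h1 h2 =>
      ⟨-r₂, h12.trans (GammaEquiv.neg _), -a, -b, δ, by simp [ha], by simp [hb], hab.neg_neg, h0,
        h1, by rw [herm_neg_left, sub_neg_eq_add, h2]⟩
    have hsq := theta_sq
    rcases hη with rfl | rfl
    · by_cases h0 : ζ = 0
      · refine neg (-2 * ⟨theta, theta_mem⟩) (fun h => ?_) isCoprime_one_left ?_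
        · exact theta_ne_zero (by simpa using congrArg Subtype.val h)
        · rw [h0] at hζ
          simp only [OneMemClass.coe_one, ZeroMemClass.coe_zero, mul_zero] at hζ
          have e2 : (((2 : Eis)) : ℂ) = 2 := rfl
          push_cast [e2]
          linear_combination -hζ + 2 * hsq
      · exact ⟨r₂, h12, a, b, ζ, ha, hb, hab, h0, isCoprime_one_left, hζ⟩
    · have hne : ∀ x : Eis, IsCoprime ⟨theta, theta_mem⟩ x → x ≠ 0 := by
        rintro _ ⟨u, v, huv⟩ rfl
        rw [mul_zero, add_zero] at huv
        have h := congrArg nrm huv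
        have h1 : nrm 1 = 1 := by simpa using nrm_natCast 1
        rw [nrm_mul, nrm_theta, h1] at h
        omega
      rcases isCoprime_theta_or ζ with h | h
      · exact ⟨r₂, h12, a, b, ζ, ha, hb, hab, hne _ h, h, hζ⟩
      · refine neg _ (hne _ h) h ?_
        have e2 : (((2 : Eis)) : ℂ) = 2 := rfl
        push_cast [e2]
        linear_combination -hζ + 2 * hsq
  -- `b` is moved by a transvection with `l = 0`, and then exchanged with `a`
  obtain ⟨n, hn⟩ := CubicMod.exists_coprime_nrm hab (nrm_ne_zero hδ0)
  have hT := exists_transvection (l := 0) (τ := n) (zero_mem K) (intCast_mem _ _)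
    (by simp) r₃
  rw [herm_zero_right, zero_div, zero_add, smul_zero, add_zero] at hT
  refine ⟨_, (h₃.trans hT).trans (exists_swap _), -(b + n * a), δ, ?_, hδ0, hδη, ?_, ?_⟩
  · simp [ha, hb]
    ring
  · rw [← hδ]
    simp only [herm_add_left, herm_smul_left, herm_e_nine_left, herm_e_ten_left, hk₀9, hk₀10,
      map_zero]
    ring
  · rw [nrm_neg]
    exact hn

/-- All roots of a given type are equivalent to the root `k₀ ∈ K`, provided that the value `θ η` of
`⟨·, k₀⟩` is attained at some `y ∈ K` with `⟨y, Λ⟩ ⊆ θηℰ`, and that vectors `m ∈ K ∩ k₀^⊥` with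
`⟨m, Λ⟩ ⊆ θηℰ` are divisible by `η`. -/
theorem IsRoot.gammaEquiv {η : Eis} (hη : IsRootType η) {k₀ y : W} (hk₀ : IsRoot η k₀)
    (hK : k₀ ∈ K) (hyK : y ∈ K) (hy : ∀ x ∈ lattice, ∃ z : Eis, herm y x = theta * η * z)
    (hyk : herm y k₀ = theta * η)
    (hP : ∀ m ∈ K, (∀ x ∈ lattice, ∃ z : Eis, herm m x = theta * η * z) → herm m k₀ = 0 →
      ∃ m₁ ∈ K, m = (η : ℂ) • m₁)
    {r : W} (hr : IsRoot η r) : GammaEquiv r k₀ := by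
  obtain ⟨r', h₁, a, δ, ha, hδ0, hδη, hδ, hcop⟩ := hr.exists_coprime_nrm hη hk₀ hK
  refine h₁.trans ?_
  replace hr := hr.of_equiv h₁
  clear h₁
  have ht := theta_ne_zero
  have hη0 : (η : ℂ) ≠ 0 := fun h => hη.ne_zero (Subtype.ext h)
  have hδ0' : (δ : ℂ) ≠ 0 := fun h => hδ0 (Subtype.ext h)
  obtain ⟨u, v, huv⟩ := Nat.isCoprime_iff_coprime.mpr hcop
  have huv' : (u : ℂ) * (a * conj (a : ℂ)) + v * (δ * conj (δ : ℂ)) = 1 := by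
    rw [mul_conj_eq, mul_conj_eq]
    exact_mod_cast huv
  obtain ⟨b₀, hb₀⟩ := hr.exists_ten
  -- with `k` the `K`-component of the root, `k - k₀ + δ y` is orthogonal to `k₀`
  have hkK := sub_mem_K hr.mem
  set k := r' - r' 9 • e 9 - r' 10 • e 10 with hk
  have hkk₀ : herm k k₀ = 3 - theta * η * δ := by
    rw [hk]
    simp only [herm_sub_left, herm_smul_left, herm_e_nine_left, herm_e_ten_left, hK.2.1, hK.2.2,
      map_zero]
    linear_combination -hδ
  have hmL : ∀ x ∈ lattice, ∃ z : Eis, herm (k - k₀ + (δ : ℂ) • y) x = theta * η * z := by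
    intro x hx
    obtain ⟨z₁, h₁⟩ := hr.exists_eq x hx
    obtain ⟨z₂, h₂⟩ := hk₀.exists_eq x hx
    obtain ⟨z₃, h₃⟩ := hy x hx
    refine ⟨z₁ - a * ⟨conj (x 10), conj_mem (hx 10)⟩ + b₀ * ⟨conj (x 9), conj_mem (hx 9)⟩
      - z₂ + δ * z₃, ?_⟩
    rw [hk]
    simp only [herm_add_left, herm_sub_left, herm_smul_left, herm_e_nine_left, herm_e_ten_left,
      h₁, h₂, h₃, ha, hb₀]
    push_cast
    ring
  have hmk₀ : herm (k - k₀ + (δ : ℂ) • y) k₀ = 0 := by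
    rw [herm_add_left, herm_sub_left, herm_smul_left, hkk₀, hk₀.norm, hyk]; ring
  obtain ⟨m₁, hm₁K, hm₁⟩ := hP _ (add_mem (sub_mem hkK hK) (smul_mem_K δ.2 hyK)) hmL hmk₀
  have hm₁k₀ : herm m₁ k₀ = 0 := by
    have h : herm ((η : ℂ) • m₁) k₀ = 0 := by
      rw [← hm₁, hmk₀]
    rw [herm_smul_left] at h
    exact (mul_eq_zero.mp h).resolve_left hη0
  -- as `u ā` inverts `a` modulo `δ`, a transvection along `l` makes the `K`-component congruent
  -- to `k₀` modulo `δ`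
  set l : W := (-(u * conj (a : ℂ))) • m₁ with hl
  have huc : (u * conj (a : ℂ)) ∈ Eis := mul_mem (intCast_mem _ _) (conj_mem a.2)
  have hlK : l ∈ K := smul_mem_K (neg_mem huc) hm₁K
  set κ : W := -y + (η * (v * conj (δ : ℂ))) • m₁ with hκ
  have hκK : κ ∈ K := add_mem (neg_mem hyK) (smul_mem_K (mul_mem η.2
    (mul_mem (intCast_mem _ _) (conj_mem δ.2))) hm₁K)
  have hκk₀ : herm κ k₀ = -(theta * η) := by
    rw [hκ, herm_add_left, herm_neg_left, herm_smul_left, hm₁k₀, hyk]; ring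
  have hκl : k + (η * a : ℂ) • l = k₀ + (δ : ℂ) • κ := by
    have : k = k₀ - (δ : ℂ) • y + (η : ℂ) • m₁ := by rw [← hm₁]; abel
    rw [this, hl, hκ]
    match_scalars
    · ring
    · ring
    · linear_combination -(η : ℂ) * huv'
  obtain ⟨τ, hτ, hlτ⟩ := exists_transvection_param hlK
  obtain ⟨z, hz⟩ := hr.exists_eq l hlK.1
  obtain ⟨b₁, hb₁⟩ : ∃ b₁ : Eis, b₁ = b₀ + z + a * ⟨τ, hτ⟩ := ⟨_, rfl⟩
  have hτn : ∀ n : ℤ, GammaEquiv r' (k₀ + (δ : ℂ) • κ + (η * a : ℂ) • e 9 +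
      (η * (b₁ + n * a) : ℂ) • e 10) := by
    intro n
    have h := exists_transvection hlK (add_mem hτ (intCast_mem Eis n))
      (by rw [hlτ, map_add, map_intCast]; ring) r'
    convert h using 1
    rw [← hκl, hk, hz, ha, hb₀, hb₁]
    push_cast
    match_scalars <;> field_simp <;> ring
  -- the norm of the transformed root determines `δ + η̄ ā b₁` modulo `δ δ̄`
  obtain ⟨j, hj⟩ := exists_herm_self hκK.1
  obtain ⟨w, q, hq, hY⟩ := hη.exists_eq_add (Y := δ + conj (η : ℂ) * conj (a : ℂ) * b₁)
    (add_mem δ.2 (mul_mem (mul_mem (conj_mem η.2) (conj_mem a.2)) b₁.2)) (D := nrm δ) (j := j) (by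
    have h := (hr.of_equiv (hτn 0)).norm
    have hk₀κ : herm k₀ κ = -conj (theta * η) := by rw [← conj_herm, hκk₀, map_neg]
    simp only [herm_add_left, herm_add_right, herm_smul_left, herm_smul_right, herm_e_nine,
      herm_e_ten, herm_e_nine_left, herm_e_ten_left, hK.2.1, hK.2.2, hκK.2.1, hκK.2.2, hκk₀,
      hk₀κ, hj, hk₀.norm, map_zero, e_nine_nine, e_nine_ten, e_ten_nine, e_ten_ten,
      Pi.add_apply, Pi.smul_apply, smul_eq_mul, map_mul, conj_theta, Int.cast_zero, zero_mul,
      add_zero] at h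
    have hD := mul_conj_eq δ
    simp only [map_add, map_mul, conj_theta, Complex.conj_conj, Int.cast_natCast]
    rw [← hD]
    linear_combination -h)
  -- `n = - w u` solves the remaining congruence
  have hab : (δ : ℂ) + conj (η : ℂ) * conj (a : ℂ) * (b₁ + ((-(w * u) : ℤ) : ℂ) * a) =
      δ * conj (δ : ℂ) * (q + conj (η : ℂ) * w * v) := by
    rw [Int.cast_natCast, ← mul_conj_eq] at hY
    push_cast
    linear_combination hY - conj (η : ℂ) * w * huv'
  obtain ⟨b₂, hb₂⟩ : ∃ b₂ : Eis, b₂ = b₁ + ((-(w * u) : ℤ) : Eis) * a := ⟨_, rfl⟩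
  have hb₂' : (b₂ : ℂ) = b₁ + ((-(w * u) : ℤ) : ℂ) * a := by rw [hb₂]; push_cast; ring
  obtain ⟨b, hb⟩ : δ ∣ b₂ := by
    have h1 : δ ∣ η * (conjE a * b₂) := by
      obtain ⟨ε, hε⟩ : ∃ ε : Eis, (η : ℂ) = ε * conj (η : ℂ) := by
        rcases hη.conj_eq with h | h
        · exact ⟨1, by rw [h]; simp⟩
        · exact ⟨-1, by rw [h]; simp⟩
      refine ⟨ε * (conjE δ * (⟨q, hq⟩ + conjE η * w * v) - 1), Subtype.ext ?_⟩
      rw [← hb₂'] at hab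
      push_cast [coe_conjE]
      linear_combination (ε : ℂ) * hab + conj (a : ℂ) * b₂ * hε
    have h2 : δ ∣ conjE a * b₂ := hδη.symm.dvd_of_dvd_mul_left h1
    have h3 : b₂ = u * a * (conjE a * b₂) + δ * (v * conjE δ * b₂) := by
      apply Subtype.ext
      push_cast [coe_conjE]
      linear_combination -(b₂ : ℂ) * huv'
    rw [h3]
    exact dvd_add (dvd_mul_of_dvd_right h2 _) (dvd_mul_right _ _)
  refine (hτn (-(w * u))).trans (gammaEquiv_of_congruence (b := b)
    (w := q + conj (η : ℂ) * w * v) hK hκK hk₀.norm hη0 η.2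
    hη.conj_eq δ.2 hδ0' a.2 b.2 ?_ ?_ (hr.of_equiv (hτn _)).norm hκk₀ ?_ ?_)
  · exact add_mem hq (mul_mem (mul_mem (conj_mem η.2) (intCast_mem _ _)) (intCast_mem _ _))
  · rw [← hb₂', hb]
    push_cast
    congr 2
    ring
  · intro x hx
    obtain ⟨z₁, h₁⟩ := hy x hx
    obtain ⟨z₂, h₂⟩ := hmL x hx
    rw [hm₁] at h₂
    obtain ⟨ε, hε⟩ : ∃ ε : Eis, conj (η : ℂ) = ε * η := by
      rcases hη.conj_eq with h | h
      · exact ⟨1, by rw [h]; simp⟩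
      · exact ⟨-1, by rw [h]; simp⟩
    rw [herm_smul_left] at h₂
    refine ⟨-ε * conj (-z₁ + v * conj (δ : ℂ) * z₂ : ℂ), mul_mem (neg_mem ε.2) (conj_mem
      (add_mem (neg_mem z₁.2) (mul_mem (mul_mem (intCast_mem _ _) (conj_mem δ.2)) z₂.2))), ?_⟩
    have h : herm κ x = theta * η * (-z₁ + v * conj (δ : ℂ) * z₂) := by
      rw [hκ, herm_add_left, herm_neg_left, herm_smul_left, h₁]
      linear_combination v * conj (δ : ℂ) * h₂
    rw [← conj_herm, h, map_mul, map_mul, conj_theta, hε]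
    ring
  · rw [← hb₂', hb] at hab
    push_cast at hab
    exact mul_left_cancel₀ hδ0' (by linear_combination hab)

/-! ### Nodal and chordal roots -/

lemma e_mem_K {i : Fin 11} (h9 : i ≠ 9) (h10 : i ≠ 10) : e i ∈ K :=
  ⟨e_mem i, by simp [e, h9.symm], by simp [e, h10.symm]⟩

lemma isRoot_e_one : IsRoot 1 (e 1) := by
  refine ⟨e_mem 1, ?_, fun x hx => ?_, e 2, e_mem 2, ?_⟩
  · rw [herm_e_one]; simp [e]
  · obtain ⟨z, hz, h⟩ := exists_herm_eq (e_mem 1) hx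
    exact ⟨⟨z, hz⟩, by simp [h]⟩
  · rw [herm_e_two]; simp [e]

lemma isRoot_e_zero : IsRoot ⟨theta, theta_mem⟩ (e 0) := by
  refine ⟨e_mem 0, ?_, fun x hx => ⟨-⟨conj (x 0), conj_mem (hx 0)⟩, ?_⟩,
    -e 0, neg_mem (e_mem 0), ?_⟩
  · rw [herm_e_zero]; simp [e]
  · rw [← conj_herm, herm_e_zero, map_mul, map_ofNat]
    push_cast
    linear_combination conj (x 0) * theta_sq
  · rw [herm_neg_right, herm_e_zero, theta_sq]
    simp [e]

lemma gammaEquiv_e_one {r : W} (hr : IsRoot 1 r) : GammaEquiv r (e 1) := by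
  refine IsRoot.gammaEquiv (y := -e 2) (Or.inl rfl) isRoot_e_one (e_mem_K (by decide) (by decide))
    (neg_mem (e_mem_K (by decide) (by decide))) (fun x hx => ?_) ?_
    (fun m hm _ _ => ⟨m, hm, by simp⟩) hr
  · obtain ⟨z, hz, h⟩ := exists_herm_eq (neg_mem (e_mem 2)) hx
    exact ⟨⟨z, hz⟩, by simp [h]⟩
  · rw [herm_neg_left, herm_e_one]
    simp [e]

/-- The divisibility in `K ∩ (e 0)^⊥` holds because the block `B` is `θ` times a matrix invertible
over `ℰ`. -/
lemma gammaEquiv_e_zero {r : W} (hr : IsRoot ⟨theta, theta_mem⟩ r) : GammaEquiv r (e 0) := by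
  have tt := theta_sq
  have ht := theta_ne_zero
  refine IsRoot.gammaEquiv (y := -e 0) (Or.inr rfl) isRoot_e_zero
    (e_mem_K (by decide) (by decide)) (neg_mem (e_mem_K (by decide) (by decide)))
    (fun x hx => ?_) ?_ (fun m hm hmL hm0 => ?_) hr
  · obtain ⟨z, hz⟩ := isRoot_e_zero.exists_eq x hx
    exact ⟨-z, by rw [herm_neg_left, hz]; push_cast; ring⟩
  · rw [herm_neg_left, herm_e_zero, theta_sq]
    simp [e]
  · have block : ∀ p q r s : ℂ, p ∈ Eis → q ∈ Eis → r ∈ Eis → s ∈ Eis →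
        (∃ w : Eis, 3 * p - theta * q = theta * theta * w) →
        (∃ w : Eis, theta * p + 3 * q - theta * r = theta * theta * w) →
        (∃ w : Eis, theta * q + 3 * r - theta * s = theta * theta * w) →
        (∃ w : Eis, theta * r + 3 * s = theta * theta * w) →
        (∃ z ∈ Eis, p = theta * z) ∧ (∃ z ∈ Eis, q = theta * z) ∧
          (∃ z ∈ Eis, r = theta * z) ∧ ∃ z ∈ Eis, s = theta * z := by
      rintro p q r s hp hq hr hs ⟨w₁, h₁⟩ ⟨w₂, h₂⟩ ⟨w₃, h₃⟩ ⟨w₄, h₄⟩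
      have eq : q = theta * (-p - w₁) :=
        mul_left_cancel₀ ht (by linear_combination -h₁ + p * tt)
      have er : r = theta * (w₄ + s) :=
        mul_left_cancel₀ ht (by linear_combination h₄ - s * tt)
      have ep : p = theta * (w₂ + q + w₄ + s) :=
        mul_left_cancel₀ ht (by linear_combination h₂ - q * tt + theta * er)
      have es : s = theta * (-p - w₁ - r - w₃) :=
        mul_left_cancel₀ ht (by linear_combination -h₃ + r * tt + theta * eq)
      exact ⟨⟨_, add_mem (add_mem (add_mem w₂.2 hq) w₄.2) hs, ep⟩,
        ⟨_, sub_mem (neg_mem hp) w₁.2, eq⟩, ⟨_, add_mem w₄.2 hs, er⟩,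
        ⟨_, sub_mem (sub_mem (sub_mem (neg_mem hp) w₁.2) hr) w₃.2, es⟩⟩
    have h := fun i => hmL _ (e_mem i)
    have hi := mem_lattice.mp hm.1
    obtain ⟨h1, h2, h3, h4⟩ := block (m 1) (m 2) (m 3) (m 4) (hi 1) (hi 2) (hi 3) (hi 4)
      (by rw [← herm_e_one]; exact h 1) (by rw [← herm_e_two]; exact h 2)
      (by rw [← herm_e_three]; exact h 3) (by rw [← herm_e_four]; exact h 4)
    obtain ⟨h5, h6, h7, h8⟩ := block (m 5) (m 6) (m 7) (m 8) (hi 5) (hi 6) (hi 7) (hi 8)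
      (by rw [← herm_e_five]; exact h 5) (by rw [← herm_e_six]; exact h 6)
      (by rw [← herm_e_seven]; exact h 7) (by rw [← herm_e_eight]; exact h 8)
    have h0 : ∃ z ∈ Eis, m 0 = theta * z := by
      rw [herm_e_zero] at hm0
      exact ⟨0, zero_mem _, by simpa using hm0⟩
    have h9 : ∃ z ∈ Eis, m 9 = theta * z := ⟨0, zero_mem _, by rw [hm.2.1, mul_zero]⟩
    have h10 : ∃ z ∈ Eis, m 10 = theta * z := ⟨0, zero_mem _, by rw [hm.2.2, mul_zero]⟩
    have hall : ∀ i, ∃ z ∈ Eis, m i = theta * z := by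
      intro i
      fin_cases i
      exacts [h0, h1, h2, h3, h4, h5, h6, h7, h8, h9, h10]
    choose m₁ hm₁ hmm using hall
    refine ⟨m₁, ⟨hm₁, ?_, ?_⟩, funext hmm⟩
    · exact (mul_eq_zero.mp ((hmm 9).symm.trans hm.2.1)).resolve_left ht
    · exact (mul_eq_zero.mp ((hmm 10).symm.trans hm.2.2)).resolve_left ht

lemma range_eq_iff {r : W} (c : ℂ) :
    (Set.range (fun x : Lam => herm r (toC x)) = Set.range fun a : Eis => c * (a : ℂ)) ↔
      (∀ x ∈ lattice, ∃ z : Eis, herm r x = c * z) ∧ ∃ x ∈ lattice, herm r x = c := by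
  constructor
  · intro h
    refine ⟨fun x hx => ?_, ?_⟩
    · obtain ⟨x, rfl⟩ := exists_toC hx
      obtain ⟨z, hz⟩ := h.subset ⟨x, rfl⟩
      exact ⟨z, hz.symm⟩
    · obtain ⟨x, hx⟩ := h.superset ⟨1, rfl⟩
      exact ⟨toC x, toC_mem x, by simpa using hx⟩
  · rintro ⟨h₁, x, hx, h₂⟩
    refine Set.Subset.antisymm ?_ ?_
    · rintro _ ⟨x, rfl⟩
      obtain ⟨z, hz⟩ := h₁ _ (toC_mem x)
      exact ⟨z, hz.symm⟩
    · rintro _ ⟨a, rfl⟩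
      obtain ⟨y, hy⟩ := exists_toC (smul_mem_lattice (conj_mem a.2) hx)
      refine ⟨y, ?_⟩
      simp only [hy, herm_smul_right, h₂, Complex.conj_conj]
      ring

lemma isNodalRoot_iff {r : Lam} : IsNodalRoot r ↔ IsRoot 1 (toC r) := by
  have h := range_eq_iff (r := toC r) theta
  constructor
  · rintro ⟨h₁, h₂⟩
    have h₃ := h.mp h₂
    exact ⟨toC_mem r, h₁, by simpa using h₃.1, by simpa using h₃.2⟩
  · intro hr
    exact ⟨hr.norm, h.mpr ⟨by simpa using hr.exists_eq, by simpa using hr.exists_unit⟩⟩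

lemma isChordalRoot_iff {r : Lam} : IsChordalRoot r ↔ IsRoot ⟨theta, theta_mem⟩ (toC r) := by
  have h := range_eq_iff (r := toC r) (theta * theta)
  have h3 : (Set.range fun a : Eis => theta * theta * (a : ℂ)) =
      Set.range fun a : Eis => 3 * (a : ℂ) := by
    rw [theta_sq]
    refine (Function.Surjective.range_comp neg_surjective (fun a : Eis => -3 * (a : ℂ))).symm.trans
      (congrArg _ (funext fun a => ?_))
    simp
  rw [h3] at h
  constructor
  · rintro ⟨h₁, h₂⟩
    have h₃ := h.mp h₂
    exact ⟨toC_mem r, h₁, h₃.1, h₃.2⟩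
  · intro hr
    exact ⟨hr.norm, h.mpr ⟨hr.exists_eq, hr.exists_unit⟩⟩

/-! ### Hyperplanes -/

lemma mem_perp_iff (g : Gamma) {r r' : Lam}
    (h : (extend g : Matrix (Fin 11) (Fin 11) ℂ) *ᵥ toC r = toC r') (p : CH) :
    g • p ∈ perp r' ↔ p ∈ perp r := by
  have mk : ∀ (v : W) (hv : v ≠ 0) (s : Lam),
      (∀ w ∈ (Projectivization.mk ℂ v hv).submodule, herm w (toC s) = 0) ↔
        herm v (toC s) = 0 := by
    intro v hv s
    rw [Projectivization.submodule_mk]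
    refine ⟨fun H => H v (Submodule.mem_span_singleton_self v), fun H w hw => ?_⟩
    obtain ⟨c, rfl⟩ := Submodule.mem_span_singleton.mp hw
    rw [herm_smul_left, H, mul_zero]
  obtain ⟨p, hp⟩ := p
  induction p using Projectivization.ind with
  | h v hv =>
    change (∀ w ∈ (extend g • Projectivization.mk ℂ v hv).submodule, herm w (toC r') = 0) ↔
      ∀ w ∈ (Projectivization.mk ℂ v hv).submodule, herm w (toC r) = 0
    rw [Projectivization.smul_mk, mk, mk, ← h]
    change herm ((extend g : Matrix (Fin 11) (Fin 11) ℂ) *ᵥ v) _ = 0 ↔ _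
    rw [herm_extend]

lemma smul_perp (g : Gamma) {r r' : Lam}
    (h : (extend g : Matrix (Fin 11) (Fin 11) ℂ) *ᵥ toC r = toC r') :
    (QuotientGroup.mk g : PGamma) • perp r = perp r' := by
  ext p
  rw [Set.mem_smul_set_iff_inv_smul_mem, ← mem_perp_iff g h]
  change (QuotientGroup.mk g : PGamma) • (QuotientGroup.mk g : PGamma)⁻¹ • p ∈ _ ↔ _
  rw [smul_inv_smul]

/-- If all roots of one type are equivalent to a fixed one, their hyperplanes form one orbit. -/
lemma orbit_eq {η : Eis} {k₀ : W}
    (hk : ∀ r, IsRoot η r → GammaEquiv r k₀) {H : Set CH}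
    (hH : ∃ r : Lam, IsRoot η (toC r) ∧ H = perp r) :
    MulAction.orbit PGamma H = {H | ∃ r : Lam, IsRoot η (toC r) ∧ H = perp r} := by
  obtain ⟨r, hr, rfl⟩ := hH
  ext H'
  constructor
  · rintro ⟨γ, rfl⟩
    obtain ⟨g, rfl⟩ := QuotientGroup.mk_surjective γ
    exact ⟨_, hr.of_equiv ⟨g, (toC_mulVec g r).symm⟩, smul_perp g (toC_mulVec g r).symm⟩
  · rintro ⟨r', hr', rfl⟩
    obtain ⟨g, hg⟩ := hk _ hr
    obtain ⟨g', hg'⟩ := hk _ hr'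
    refine ⟨(QuotientGroup.mk (g'⁻¹ * g) : PGamma), smul_perp _ ?_⟩
    rw [map_mul, Units.val_mul, ← Matrix.mulVec_mulVec, hg, ← hg', Matrix.mulVec_mulVec,
      ← Units.val_mul, ← map_mul, inv_mul_cancel, map_one, Units.val_one, Matrix.one_mulVec]

end CubicMod
end

/-- `PΓ` acts transitively on the (nonempty) set of discriminant hyperplanes and on the (nonempty)
set of chordal hyperplanes in `ℂH¹⁰`: each of these sets is a single `PΓ`-orbit. -/
theorem mainTheorem12 :
    (CubicMod.discriminantHyperplanes.Nonempty ∧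
      ∀ H ∈ CubicMod.discriminantHyperplanes,
        MulAction.orbit CubicMod.PGamma H = CubicMod.discriminantHyperplanes) ∧
    (CubicMod.chordalHyperplanes.Nonempty ∧
      ∀ H ∈ CubicMod.chordalHyperplanes,
        MulAction.orbit CubicMod.PGamma H = CubicMod.chordalHyperplanes) := by
  have h₁ : CubicMod.discriminantHyperplanes =
      {H | ∃ r : CubicMod.Lam, CubicMod.IsRoot 1 (CubicMod.toC r) ∧ H = CubicMod.perp r} := by
    simp only [CubicMod.discriminantHyperplanes, CubicMod.isNodalRoot_iff]
  have h₂ : CubicMod.chordalHyperplanes =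
      {H | ∃ r : CubicMod.Lam, CubicMod.IsRoot ⟨CubicMod.theta, CubicMod.theta_mem⟩
        (CubicMod.toC r) ∧ H = CubicMod.perp r} := by
    simp only [CubicMod.chordalHyperplanes, CubicMod.isChordalRoot_iff]
  rw [h₁, h₂]
  refine ⟨⟨⟨_, Pi.single 1 1, ?_, rfl⟩, fun H hH => CubicMod.orbit_eq
    (fun _ => CubicMod.gammaEquiv_e_one) hH⟩, ⟨⟨_, Pi.single 0 1, ?_, rfl⟩, fun H hH =>
    CubicMod.orbit_eq (fun _ => CubicMod.gammaEquiv_e_zero) hH⟩⟩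
  · rw [CubicMod.toC_single]
    exact CubicMod.isRoot_e_one
  · rw [CubicMod.toC_single]
    exact CubicMod.isRoot_e_zero
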